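/- A \emph{straight-line program} (SLP) is a nonempty finite sequence of variables $X_0,\dots,X_{m-1}$, each with exactly one rule, which is either $X_k\to a$ with a terminal symbol $a$, or $X_k\to X_\ell X_r$ with $\ell,r<k$. The last variable is the start symbol, so the SLP generates exactly one string $S=s_1s_2\cdots s_N$. The \emph{size} $n$ of the SLP is the total number of symbols in all its rules (left-hand and right-hand sides); in particular $n\ge 2$. The machine model is the unit-cost word RAM: a program is a fixed finite text using finitely many registers and an addressable memory of words, with operations $+$, truncated $-$, $\times$, integer division and comparisons, indirect reading and writing, branching and loops. All numbers must fit into words of $w$ bits, and words have $\Omega(\log(n+N))$ bits; variable indices, positions in $S$ and terminal symbols are single words. The space used is the number of memory cells. \textbf{Lemma.} Random access to the string of an SLP of size $n$ that generates a string of length $N$ can be supported in $O(\log N)$ time after $O(n\log n)$ preprocessing time and space. Precisely: there are two fixed word RAM programs, a preprocessing program and a query program, and constants $C,c$, such that the following holds for every SLP, with $n$, $N$, $S$ as above, and every word length $w\ge c\log_2(n+N)$ for which all terminal symbols of the SLP fit into a word. Given the rules of the SLP in memory, the preprocessing program halts after at most $C\,n\log n$ steps, using at most $C\,n\log n$ memory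 cells (the cells of the input included). From the resulting memory contents, the query program, given any $i$ with $1\le i\le N$, halts after at most $C\,(1+\log N)$ steps with output $s_i$, uses only the same memory cells, and leaves the memory contents unchanged (so that any number of queries can be answered). -/

import Mathlib

/-! ## Straight-line programs -/

/-- The right-hand side of the rule of the `k`-th variable (`k = 0, 1, …`) of a straight-line
program: one terminal symbol, or exactly two variables that precede the `k`-th one.
Terminal symbols are natural numbers (character codes). -/
inductive SLPRule (k : ℕ) : Type
  | terminal (a : ℕ) : SLPRule k
  | pair (l r : Fin k) : SLPRule k

/-- The number of symbols of the rule: the left-hand side and the symbols on the right. -/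
def SLPRule.symbols {k : ℕ} : SLPRule k → ℕ
  | .terminal _ => 2
  | .pair _ _ => 3

/-- A straight-line program: a nonempty finite sequence of variables `X₀, X₁, …`, each with one
rule; the start symbol is the last variable. -/
structure SLP : Type where
  numVars : ℕ
  numVars_pos : 0 < numVars
  rule : (k : Fin numVars) → SLPRule k.val

namespace SLP

/-- The string derived from the variable with index `k`. -/
def expand (G : SLP) (k : ℕ) (hk : k < G.numVars) : List ℕ :=
  match G.rule ⟨k, hk⟩ with
  | .terminal a => [a]
  | .pair l r =>
      expand G l.val (l.isLt.trans hk) ++ expand G r.val (r.isLt.trans hk)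
termination_by k
decreasing_by
  · exact l.isLt
  · exact r.isLt

/-- The string generated by the straight-line program. -/
def word (G : SLP) : List ℕ :=
  G.expand (G.numVars - 1) (Nat.sub_lt G.numVars_pos Nat.one_pos)

/-- The size of the grammar: the total number of symbols in all its rules. -/
def size (G : SLP) : ℕ := ∑ k : Fin G.numVars, (G.rule k).symbols

/-- The three words that describe a rule in the input: `0, a, 0` for the terminal `a`, and
`1, l, r` for a pair of variables. -/
def ruleCode {k : ℕ} : SLPRule k → Fin 3 → ℕ
  | .terminal a => ![0, a, 0]
  | .pair l r => ![1, l.val, r.val]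

/-- The memory that holds the grammar: the rule of the `k`-th variable is in the cells
`3 * k`, `3 * k + 1`, `3 * k + 2`, and all other cells are `0`. -/
def inputMem (G : SLP) (j : ℕ) : ℕ :=
  if h : j / 3 < G.numVars then
    ruleCode (G.rule ⟨j / 3, h⟩) ⟨j % 3, Nat.mod_lt j (by decide)⟩
  else 0

end SLP

/-! ## Word RAM

A program is a fixed finite text; it uses a fixed finite number of registers and an addressable
memory. On a machine with word length `w` and `s` memory cells, every number that is computed has
to be less than `2 ^ w`, and every address that is used has to be less than `s`; an execution
that violates this is not an execution. Every evaluated node of an expression and every executed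
statement or loop test costs one unit of time. -/

namespace WordRAM

/-- The contents of the registers and of the memory cells. -/
@[ext] structure State : Type where
  reg : ℕ → ℕ
  mem : ℕ → ℕ

/-- The arithmetic and comparison operations on words. -/
inductive Op : Type
  | add | sub | mul | div | lt | eq

/-- Subtraction is truncated at `0`, division is rounded down (with quotient `0` for divisor `0`),
and a comparison yields `1` or `0`. -/
def Op.eval : Op → ℕ → ℕ → ℕ
  | .add, x, y => x + y
  | .sub, x, y => x - y
  | .mul, x, y => x * y
  | .div, x, y => x / y
  | .lt, x, y => if x < y then 1 else 0
  | .eq, x, y => if x = y then 1 else 0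

/-- Expressions: a constant, a register, the memory cell at a computed address, an operation. -/
inductive Expr : Type
  | const (c : ℕ) : Expr
  | reg (r : ℕ) : Expr
  | load (addr : Expr) : Expr
  | op (o : Op) (a b : Expr) : Expr

namespace Expr

/-- The value of an expression. -/
def eval (σ : State) : Expr → ℕ
  | const c => c
  | reg r => σ.reg r
  | load a => σ.mem (a.eval σ)
  | op o a b => o.eval (a.eval σ) (b.eval σ)

/-- The time to evaluate an expression: its number of nodes. -/
def cost : Expr → ℕ
  | const _ => 1
  | reg _ => 1
  | load a => a.cost + 1
  | op _ a b => a.cost + b.cost + 1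

/-- All values in the evaluation fit into words of `w` bits, and only cells with addresses less
than `s` are read. -/
def Fits (w s : ℕ) (σ : State) : Expr → Prop
  | const c => c < 2 ^ w
  | reg r => σ.reg r < 2 ^ w
  | load a => a.Fits w s σ ∧ a.eval σ < s ∧ σ.mem (a.eval σ) < 2 ^ w
  | op o a b => a.Fits w s σ ∧ b.Fits w s σ ∧ o.eval (a.eval σ) (b.eval σ) < 2 ^ w

end Expr

/-- Programs. Conditions are expressions; a nonzero value means that the condition holds. -/
inductive Prog : Type
  | skip : Prog
  | assign (r : ℕ) (e : Expr) : Prog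
  | store (addr e : Expr) : Prog
  | seq (p q : Prog) : Prog
  | ite (c : Expr) (p q : Prog) : Prog
  | while (c : Expr) (p : Prog) : Prog

/-- `Exec w s p σ t τ`: on a machine with word length `w` and `s` memory cells, the program `p`
started in state `σ` halts after exactly `t` units of time in state `τ`. -/
inductive Exec (w s : ℕ) : Prog → State → ℕ → State → Prop
  | skip (σ : State) : Exec w s .skip σ 1 σ
  | assign (σ : State) (r : ℕ) (e : Expr) (he : e.Fits w s σ) :
      Exec w s (.assign r e) σ (e.cost + 1) ⟨Function.update σ.reg r (e.eval σ), σ.mem⟩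
  | store (σ : State) (a e : Expr) (ha : a.Fits w s σ) (has : a.eval σ < s)
      (he : e.Fits w s σ) :
      Exec w s (.store a e) σ (a.cost + e.cost + 1)
        ⟨σ.reg, Function.update σ.mem (a.eval σ) (e.eval σ)⟩
  | seq {p q : Prog} {σ τ υ : State} {t u : ℕ} (hp : Exec w s p σ t τ) (hq : Exec w s q τ u υ) :
      Exec w s (.seq p q) σ (t + u) υ
  | iteTrue {c : Expr} {p q : Prog} {σ τ : State} {t : ℕ} (hc : c.Fits w s σ)
      (h : c.eval σ ≠ 0) (hp : Exec w s p σ t τ) :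
      Exec w s (.ite c p q) σ (c.cost + 1 + t) τ
  | iteFalse {c : Expr} {p q : Prog} {σ τ : State} {t : ℕ} (hc : c.Fits w s σ)
      (h : c.eval σ = 0) (hq : Exec w s q σ t τ) :
      Exec w s (.ite c p q) σ (c.cost + 1 + t) τ
  | whileTrue {c : Expr} {p : Prog} {σ τ υ : State} {t u : ℕ} (hc : c.Fits w s σ)
      (h : c.eval σ ≠ 0) (hp : Exec w s p σ t τ) (hw : Exec w s (.while c p) τ u υ) :
      Exec w s (.while c p) σ (c.cost + 1 + t + u) υ
  | whileFalse {c : Expr} {p : Prog} {σ : State} (hc : c.Fits w s σ) (h : c.eval σ = 0) :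
      Exec w s (.while c p) σ (c.cost + 1) σ

/-- The state at the start of a program: the argument `x` is in register `0`, all other registers
are `0`, and the memory is `m`. -/
def start (x : ℕ) (m : ℕ → ℕ) : State := ⟨Function.update 0 0 x, m⟩

end WordRAM

/-! Write N for the length of the generated string, `len k` for the length derived from a variable,
`occ k` for its number of occurrences in the derivation tree, and `level k` for the rounded-down
binary logarithm of `len k`. Since `occ k * len k ≤ N` (`occ_mul_len_le`), both numbers are at most
N for every variable that occurs. An edge from `k` to a child `z` is kept if `level z = level k` and
`occ z < 2 * occ k`. At most one edge out of `k` is kept, because two children of the same level as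
`k` would be too long together (`not_both_level`). At most one edge into `z` is kept, because two
different parents would give `occ z` at least the sum of their counts (`next_inj`). So the kept
edges split the variables that occur into disjoint paths, and every other edge lowers the level or
doubles the number of occurrences (`light_child`). A root-to-leaf walk in the derivation tree
therefore uses O(log N) edges between paths.

Along one path the derived strings are nested, so the last variable whose string covers a given
position can be found by search. Each path gets a binary search tree in which an interval of the
path is split where the lengths cross the middle between its two extreme lengths, so that the weight
of the interval, the total length that leaves the path there, is at least halved (`Search.descend`).
The part that leaves the path at the exit is at most the weight of the last interval visited, and it
is at least as long as the next variable; hence the logarithms of the weights telescope over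
consecutive paths (`Search.continue_search`). The sum of the logarithm of the weight, the level, and
the number of doublings of `occ` still possible drops in every step, which gives O(log N) steps per
query.

For the preprocessing, counts, lengths and paths take linear time. The search trees have at most
three nodes per variable, and a binary search finds each split, for O(n log n) in total. The
correctness of the programs is derived with a weakest-precondition calculus that also counts time
(`WP.exec`, `WP.while`). -/

namespace WordRAM

/-! ### Time-counting weakest preconditions -/

/-- The side conditions under which an expression fits, provided that all registers and all memory
cells hold words. -/
def Expr.Safe (w s : ℕ) (σ : State) : Expr → Prop
  | .const c => c ≤ 16
  | .reg _ => True
  | .load a => a.Safe w s σ ∧ a.eval σ < s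
  | .op .add a b => a.Safe w s σ ∧ b.Safe w s σ ∧ a.eval σ + b.eval σ < 2 ^ w
  | .op .mul a b => a.Safe w s σ ∧ b.Safe w s σ ∧ a.eval σ * b.eval σ < 2 ^ w
  | .op _ a b => a.Safe w s σ ∧ b.Safe w s σ

/-- All registers and all memory cells hold words of `w` bits. -/
def State.Words (w : ℕ) (σ : State) : Prop :=
  (∀ r, σ.reg r < 2 ^ w) ∧ ∀ a, σ.mem a < 2 ^ w

theorem Expr.Fits.eval_lt {w s : ℕ} {σ : State} : ∀ {e : Expr}, e.Fits w s σ → e.eval σ < 2 ^ w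
  | .const _, h => h
  | .reg _, h => h
  | .load _, h => h.2.2
  | .op _ _ _, h => h.2.2

/-- Once all stored numbers are words, only constants, sums, products and addresses need attention:
subtraction and division do not exceed their first operand, and comparisons give 0 or 1. -/
theorem Expr.Safe.fits {w s : ℕ} {σ : State} (hw : 16 < 2 ^ w) (hσ : σ.Words w) :
    ∀ {e : Expr}, e.Safe w s σ → e.Fits w s σ
  | .const _, h => lt_of_le_of_lt h hw
  | .reg r, _ => hσ.1 r
  | .load _, h => ⟨h.1.fits hw hσ, h.2, hσ.2 _⟩
  | .op .add _ _, h => ⟨h.1.fits hw hσ, h.2.1.fits hw hσ, h.2.2⟩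
  | .op .mul _ _, h => ⟨h.1.fits hw hσ, h.2.1.fits hw hσ, h.2.2⟩
  | .op .sub _ _, h =>
    ⟨h.1.fits hw hσ, h.2.fits hw hσ, lt_of_le_of_lt (Nat.sub_le _ _) (h.1.fits hw hσ).eval_lt⟩
  | .op .div _ _, h =>
    ⟨h.1.fits hw hσ, h.2.fits hw hσ, lt_of_le_of_lt (Nat.div_le_self _ _) (h.1.fits hw hσ).eval_lt⟩
  | .op .lt _ _, h =>
    ⟨h.1.fits hw hσ, h.2.fits hw hσ, by simp only [Op.eval]; split <;> omega⟩
  | .op .eq _ _, h =>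
    ⟨h.1.fits hw hσ, h.2.fits hw hσ, by simp only [Op.eval]; split <;> omega⟩

theorem State.Words.update_reg {w : ℕ} {σ : State} (hσ : σ.Words w) (r : ℕ) {v : ℕ}
    (hv : v < 2 ^ w) : State.Words w ⟨Function.update σ.reg r v, σ.mem⟩ :=
  ⟨fun i => by simp only [Function.update_apply]; split <;> simp [hv, hσ.1], hσ.2⟩

theorem State.Words.update_mem {w : ℕ} {σ : State} (hσ : σ.Words w) (a : ℕ) {v : ℕ}
    (hv : v < 2 ^ w) : State.Words w ⟨σ.reg, Function.update σ.mem a v⟩ :=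
  ⟨hσ.1, fun i => by simp only [Function.update_apply]; split <;> simp [hv, hσ.2]⟩

/-- From `σ`, the program halts in a state that satisfies `Q` together with the time at the end,
when the time at the start is `t`. -/
def WP (w s : ℕ) : Prog → State → ℕ → (ℕ → State → Prop) → Prop
  | .skip, σ, t, Q => Q (t + 1) σ
  | .assign r e, σ, t, Q =>
    e.Safe w s σ ∧ Q (t + (e.cost + 1)) ⟨Function.update σ.reg r (e.eval σ), σ.mem⟩
  | .store a e, σ, t, Q =>
    (a.Safe w s σ ∧ a.eval σ < s ∧ e.Safe w s σ) ∧
      Q (t + (a.cost + e.cost + 1)) ⟨σ.reg, Function.update σ.mem (a.eval σ) (e.eval σ)⟩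
  | .seq p q, σ, t, Q => WP w s p σ t fun t' τ => WP w s q τ t' Q
  | .ite c p q, σ, t, Q => c.Safe w s σ ∧
      (c.eval σ ≠ 0 → WP w s p σ (t + (c.cost + 1)) Q) ∧
      (c.eval σ = 0 → WP w s q σ (t + (c.cost + 1)) Q)
  | .while c p, σ, t, Q => σ.Words w →
      ∃ t' τ, Exec w s (.while c p) σ t' τ ∧ τ.Words w ∧ Q (t + t') τ

section
variable (w s : ℕ) (σ : State) (t : ℕ) (Q : ℕ → State → Prop)

@[simp] theorem wp_skip : WP w s .skip σ t Q ↔ Q (t + 1) σ := Iff.rfl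

@[simp] theorem wp_assign (r : ℕ) (e : Expr) : WP w s (.assign r e) σ t Q ↔
    e.Safe w s σ ∧ Q (t + (e.cost + 1)) ⟨Function.update σ.reg r (e.eval σ), σ.mem⟩ := Iff.rfl

@[simp] theorem wp_store (a e : Expr) : WP w s (.store a e) σ t Q ↔
    (a.Safe w s σ ∧ a.eval σ < s ∧ e.Safe w s σ) ∧
      Q (t + (a.cost + e.cost + 1)) ⟨σ.reg, Function.update σ.mem (a.eval σ) (e.eval σ)⟩ := Iff.rfl

@[simp] theorem wp_seq (p q : Prog) :
    WP w s (.seq p q) σ t Q ↔ WP w s p σ t fun t' τ => WP w s q τ t' Q := Iff.rfl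

@[simp] theorem wp_ite (c : Expr) (p q : Prog) : WP w s (.ite c p q) σ t Q ↔
    c.Safe w s σ ∧ (c.eval σ ≠ 0 → WP w s p σ (t + (c.cost + 1)) Q) ∧
      (c.eval σ = 0 → WP w s q σ (t + (c.cost + 1)) Q) := Iff.rfl

end

/-- Soundness of the calculus. The loop case is immediate because `WP` of a loop is defined as the
existence of an execution; the reasoning about iterations is in `WP.while`. -/
theorem WP.exec {w s : ℕ} (hw : 16 < 2 ^ w) {p : Prog} :
    ∀ {σ : State} {t : ℕ} {Q : ℕ → State → Prop}, σ.Words w → WP w s p σ t Q →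
      ∃ t' τ, Exec w s p σ t' τ ∧ τ.Words w ∧ Q (t + t') τ := by
  induction p with
  | skip => exact fun hσ h => ⟨_, _, .skip _, hσ, h⟩
  | assign r e =>
    exact fun hσ h => ⟨_, _, .assign _ r e (h.1.fits hw hσ),
      hσ.update_reg r (h.1.fits hw hσ).eval_lt, h.2⟩
  | store a e =>
    exact fun hσ h => ⟨_, _, .store _ a e (h.1.1.fits hw hσ) h.1.2.1 (h.1.2.2.fits hw hσ),
      hσ.update_mem _ (h.1.2.2.fits hw hσ).eval_lt, h.2⟩
  | seq p q hp hq =>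
    intro σ t Q hσ h
    obtain ⟨t₁, τ, e₁, hτ, h₁⟩ := hp hσ h
    obtain ⟨t₂, υ, e₂, hυ, h₂⟩ := hq hτ h₁
    exact ⟨_, υ, .seq e₁ e₂, hυ, by rwa [← add_assoc]⟩
  | ite c p q hp hq =>
    intro σ t Q hσ h
    by_cases hc : c.eval σ = 0
    · obtain ⟨t₁, τ, e₁, hτ, h₁⟩ := hq hσ (h.2.2 hc)
      exact ⟨_, τ, .iteFalse (h.1.fits hw hσ) hc e₁, hτ, by rwa [← add_assoc]⟩
    · obtain ⟨t₁, τ, e₁, hτ, h₁⟩ := hp hσ (h.2.1 hc)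
      exact ⟨_, τ, .iteTrue (h.1.fits hw hσ) hc e₁, hτ, by rwa [← add_assoc]⟩
  | _ => exact fun hσ h => h hσ

theorem WP.mono {w s : ℕ} {p : Prog} : ∀ {σ : State} {t : ℕ} {Q R : ℕ → State → Prop},
    WP w s p σ t Q → (∀ t τ, Q t τ → R t τ) → WP w s p σ t R := by
  induction p with
  | skip => exact fun h hQ => hQ _ _ h
  | assign r e => exact fun h hQ => ⟨h.1, hQ _ _ h.2⟩
  | store a e => exact fun h hQ => ⟨h.1, hQ _ _ h.2⟩
  | seq p q hp hq => exact fun h hQ => hp h fun t τ h' => hq h' hQ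
  | ite c p q hp hq =>
    exact fun h hQ => ⟨h.1, fun hc => hp (h.2.1 hc) hQ, fun hc => hq (h.2.2 hc) hQ⟩
  | _ =>
    intro σ t Q R h hQ hσ
    obtain ⟨t', τ, h₁, h₂, h₃⟩ := h hσ
    exact ⟨t', τ, h₁, h₂, hQ _ _ h₃⟩

/-- A loop whose invariant `I n` allows for at most `n` further iterations, each of at most `b`
units of time. -/
theorem WP.while {w s : ℕ} (hw : 16 < 2 ^ w) {c : Expr} {p : Prog} (b : ℕ)
    (I : ℕ → State → Prop)
    (safe : ∀ n σ, I n σ → c.Safe w s σ)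
    (step : ∀ n σ, I n σ → c.eval σ ≠ 0 →
      ∃ n', n = n' + 1 ∧ WP w s p σ 0 fun t τ => t ≤ b ∧ I n' τ) :
    ∀ (n : ℕ) {σ : State} {t : ℕ} {Q : ℕ → State → Prop}, I n σ →
      (∀ t' n' τ, t' ≤ t + n * (b + c.cost + 1) + (c.cost + 1) → I n' τ → c.eval τ = 0 →
        Q t' τ) →
      WP w s (.while c p) σ t Q := by
  intro n
  induction n with
  | zero =>
    intro σ t Q hI hQ hσ
    by_cases hc : c.eval σ = 0
    · exact ⟨_, σ, .whileFalse ((safe _ _ hI).fits hw hσ) hc, hσ, hQ _ 0 _ (by omega) hI hc⟩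
    · obtain ⟨n', h, -⟩ := step _ _ hI hc
      omega
  | succ n ih =>
    intro σ t Q hI hQ hσ
    by_cases hc : c.eval σ = 0
    · exact ⟨_, σ, .whileFalse ((safe _ _ hI).fits hw hσ) hc, hσ,
        hQ _ (n + 1) _ (by nlinarith) hI hc⟩
    · obtain ⟨n', h, hp⟩ := step _ _ hI hc
      obtain rfl : n = n' := by omega
      obtain ⟨t₁, τ, e₁, hτ, h₁, hI'⟩ := hp.exec hw hσ
      obtain ⟨t₂, υ, e₂, hυ, h₂⟩ := ih (t := t + (c.cost + 1 + t₁)) hI'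
        (fun t' n' υ ht => hQ t' n' υ (by
          have : (n + 1) * (b + c.cost + 1) = n * (b + c.cost + 1) + (b + c.cost + 1) := by ring
          omega)) hτ
      exact ⟨_, υ, .whileTrue ((safe _ _ hI).fits hw hσ) hc e₁ e₂, hυ, by
        rwa [← add_assoc]⟩

/-! ### Notation for expressions and programs -/

instance : Add Expr := ⟨.op .add⟩
instance : Sub Expr := ⟨.op .sub⟩
instance : Mul Expr := ⟨.op .mul⟩
instance : Div Expr := ⟨.op .div⟩

section
variable (w s n : ℕ) (σ : State) (a b : Expr)

@[simp] theorem Expr.eval_const : (Expr.const n).eval σ = n := rfl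
@[simp] theorem Expr.eval_reg : (Expr.reg n).eval σ = σ.reg n := rfl
@[simp] theorem Expr.eval_load : (Expr.load a).eval σ = σ.mem (a.eval σ) := rfl
@[simp] theorem Expr.eval_add : (a + b).eval σ = a.eval σ + b.eval σ := rfl
@[simp] theorem Expr.eval_sub : (a - b).eval σ = a.eval σ - b.eval σ := rfl
@[simp] theorem Expr.eval_mul : (a * b).eval σ = a.eval σ * b.eval σ := rfl
@[simp] theorem Expr.eval_div : (a / b).eval σ = a.eval σ / b.eval σ := rfl
@[simp] theorem Expr.eval_lt :
    (Expr.op .lt a b).eval σ = if a.eval σ < b.eval σ then 1 else 0 := rfl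
@[simp] theorem Expr.eval_eq :
    (Expr.op .eq a b).eval σ = if a.eval σ = b.eval σ then 1 else 0 := rfl

@[simp] theorem Expr.cost_const : (Expr.const n).cost = 1 := rfl
@[simp] theorem Expr.cost_reg : (Expr.reg n).cost = 1 := rfl
@[simp] theorem Expr.cost_load : (Expr.load a).cost = a.cost + 1 := rfl
@[simp] theorem Expr.cost_add : (a + b).cost = a.cost + b.cost + 1 := rfl
@[simp] theorem Expr.cost_sub : (a - b).cost = a.cost + b.cost + 1 := rfl
@[simp] theorem Expr.cost_mul : (a * b).cost = a.cost + b.cost + 1 := rfl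
@[simp] theorem Expr.cost_div : (a / b).cost = a.cost + b.cost + 1 := rfl
@[simp] theorem Expr.cost_op (o : Op) : (Expr.op o a b).cost = a.cost + b.cost + 1 := rfl

@[simp] theorem Expr.safe_const : (Expr.const n).Safe w s σ ↔ n ≤ 16 := Iff.rfl
@[simp] theorem Expr.safe_reg : (Expr.reg n).Safe w s σ := trivial
@[simp] theorem Expr.safe_load :
    (Expr.load a).Safe w s σ ↔ a.Safe w s σ ∧ a.eval σ < s := Iff.rfl
@[simp] theorem Expr.safe_add : (a + b).Safe w s σ ↔
    a.Safe w s σ ∧ b.Safe w s σ ∧ a.eval σ + b.eval σ < 2 ^ w := Iff.rfl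
@[simp] theorem Expr.safe_mul : (a * b).Safe w s σ ↔
    a.Safe w s σ ∧ b.Safe w s σ ∧ a.eval σ * b.eval σ < 2 ^ w := Iff.rfl
@[simp] theorem Expr.safe_sub : (a - b).Safe w s σ ↔ a.Safe w s σ ∧ b.Safe w s σ := Iff.rfl
@[simp] theorem Expr.safe_div : (a / b).Safe w s σ ↔ a.Safe w s σ ∧ b.Safe w s σ := Iff.rfl
@[simp] theorem Expr.safe_lt :
    (Expr.op .lt a b).Safe w s σ ↔ a.Safe w s σ ∧ b.Safe w s σ := Iff.rfl
@[simp] theorem Expr.safe_eq :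
    (Expr.op .eq a b).Safe w s σ ↔ a.Safe w s σ ∧ b.Safe w s σ := Iff.rfl

end

/-- The sequential composition of a list of programs. -/
def block : List Prog → Prog
  | [] => .skip
  | p :: ps => .seq p (block ps)

/-! ### Records behind an input of `3 * m` cells -/

/-- The address of the field `f` of the record `k`. -/
def fieldAddr (m f k : ℕ) : ℕ := 3 * m + 16 * k + f

theorem fieldAddr_inj {m f f' k k' : ℕ} (hf : f < 16) (hf' : f' < 16) :
    fieldAddr m f k = fieldAddr m f' k' ↔ k = k' ∧ f = f' := by
  unfold fieldAddr; omega

theorem ne_fieldAddr {m a : ℕ} (ha : a < 3 * m) (f k : ℕ) : a ≠ fieldAddr m f k := by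
  unfold fieldAddr; omega

/-- There are at most `m` variables and positions, and at most `3 * m` search tree nodes, so `3 * m`
records of 16 cells behind the input suffice: `3 * m + 48 * m = 51 * m`. -/
theorem fieldAddr_lt {m k : ℕ} (hk : k < 3 * m) {f : ℕ} (hf : f < 16) :
    fieldAddr m f k < 51 * m := by
  unfold fieldAddr; omega

/-- The expression for the address of the field `f` of a record, with `m` in register `0`. -/
def addrExpr (f : ℕ) (e : Expr) : Expr :=
  Expr.const 3 * Expr.reg 0 + Expr.const 16 * e + Expr.const f

/-- The expression for the field `f` of a record. -/
def fieldExpr (f : ℕ) (e : Expr) : Expr := .load (addrExpr f e)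

section
variable (w s f : ℕ) (σ : State) (e : Expr)

@[simp] theorem eval_addrExpr :
    (addrExpr f e).eval σ = fieldAddr (σ.reg 0) f (e.eval σ) := rfl
@[simp] theorem eval_fieldExpr :
    (fieldExpr f e).eval σ = σ.mem (fieldAddr (σ.reg 0) f (e.eval σ)) := rfl
@[simp] theorem cost_addrExpr : (addrExpr f e).cost = e.cost + 8 := by
  simp only [addrExpr, Expr.cost_add, Expr.cost_mul, Expr.cost_const, Expr.cost_reg]
  omega
@[simp] theorem cost_fieldExpr : (fieldExpr f e).cost = e.cost + 9 := by
  simp [fieldExpr]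

@[simp] theorem safe_addrExpr : (addrExpr f e).Safe w s σ ↔
    e.Safe w s σ ∧ f ≤ 16 ∧ fieldAddr (σ.reg 0) f (e.eval σ) < 2 ^ w := by
  simp only [addrExpr, Expr.safe_add, Expr.safe_mul, Expr.safe_const, Expr.safe_reg,
    Expr.eval_const, Expr.eval_reg, Expr.eval_mul, Expr.eval_add, true_and, fieldAddr]
  by_cases he : e.Safe w s σ <;> simp only [he, true_and, false_and, and_false]
  omega

@[simp] theorem safe_fieldExpr : (fieldExpr f e).Safe w s σ ↔
    (e.Safe w s σ ∧ f ≤ 16 ∧ fieldAddr (σ.reg 0) f (e.eval σ) < 2 ^ w) ∧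
      fieldAddr (σ.reg 0) f (e.eval σ) < s := by
  rw [fieldExpr, Expr.safe_load, safe_addrExpr, eval_addrExpr]

end

end WordRAM

namespace SLP

variable (G : SLP)

/-! ### Access to the rules by natural numbers -/

def tag (k : ℕ) : ℕ := G.inputMem (3 * k)
def fst (k : ℕ) : ℕ := G.inputMem (3 * k + 1)
def snd (k : ℕ) : ℕ := G.inputMem (3 * k + 2)

/-- The string derived from a variable (the empty string if there is no such variable). -/
def str (k : ℕ) : List ℕ := if hk : k < G.numVars then G.expand k hk else []

/-- The length of the string derived from a variable. -/
def len (k : ℕ) : ℕ := (G.str k).length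

theorem inputMem_eq {k : ℕ} (hk : k < G.numVars) {f : ℕ} (hf : f < 3) :
    G.inputMem (3 * k + f) = ruleCode (G.rule ⟨k, hk⟩) ⟨f, hf⟩ := by
  have h1 : (3 * k + f) / 3 = k := by omega
  have h2 : (3 * k + f) % 3 = f := by omega
  have key : ∀ (a b : ℕ) (ha : a < G.numVars) (hb : b < 3), a = k → b = f →
      ruleCode (G.rule ⟨a, ha⟩) ⟨b, hb⟩ = ruleCode (G.rule ⟨k, hk⟩) ⟨f, hf⟩ := by
    rintro a b _ _ rfl rfl
    rfl
  rw [inputMem, dif_pos (h1.symm ▸ hk)]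
  exact key _ _ _ _ h1 h2

variable {G} in
theorem rule_cases {k : ℕ} (hk : k < G.numVars) :
    (G.tag k = 0 ∧ G.rule ⟨k, hk⟩ = .terminal (G.fst k) ∧ G.str k = [G.fst k]) ∨
    (G.tag k = 1 ∧ G.fst k < k ∧ G.snd k < k ∧ G.str k = G.str (G.fst k) ++ G.str (G.snd k)) := by
  have h0 : G.tag k = _ := G.inputMem_eq hk (f := 0) (by decide)
  have h1 : G.fst k = _ := G.inputMem_eq hk (f := 1) (by decide)
  have h2 : G.snd k = _ := G.inputMem_eq hk (f := 2) (by decide)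
  cases hr : G.rule ⟨k, hk⟩ with
  | terminal a =>
    rw [hr] at h0 h1 h2
    have h1' : G.fst k = a := h1
    refine .inl ⟨h0, by rw [h1'], ?_⟩
    rw [str, dif_pos hk, expand, hr, h1']
  | pair l r =>
    rw [hr] at h0 h1 h2
    have h1' : G.fst k = l.val := h1
    have h2' : G.snd k = r.val := h2
    refine .inr ⟨h0, by rw [h1']; exact l.isLt, by rw [h2']; exact r.isLt, ?_⟩
    rw [str, dif_pos hk, expand, hr, h1', h2', str, str, dif_pos (l.isLt.trans hk),
      dif_pos (r.isLt.trans hk)]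

variable {G}

theorem tag_eq {k : ℕ} (hk : k < G.numVars) : G.tag k = 0 ∨ G.tag k = 1 := by
  rcases rule_cases hk with h | h <;> simp [h.1]

theorem fst_lt {k : ℕ} (hk : k < G.numVars) (h : G.tag k = 1) : G.fst k < k := by
  rcases rule_cases hk with h' | h'
  · omega
  · exact h'.2.1

theorem snd_lt {k : ℕ} (hk : k < G.numVars) (h : G.tag k = 1) : G.snd k < k := by
  rcases rule_cases hk with h' | h'
  · omega
  · exact h'.2.2.1

theorem str_of_tag_zero {k : ℕ} (hk : k < G.numVars) (h : G.tag k = 0) : G.str k = [G.fst k] := by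
  rcases rule_cases hk with h' | h'
  · exact h'.2.2
  · omega

theorem str_of_tag_one {k : ℕ} (hk : k < G.numVars) (h : G.tag k = 1) :
    G.str k = G.str (G.fst k) ++ G.str (G.snd k) := by
  rcases rule_cases hk with h' | h'
  · omega
  · exact h'.2.2.2

theorem len_of_tag_zero {k : ℕ} (hk : k < G.numVars) (h : G.tag k = 0) : G.len k = 1 := by
  simp [len, str_of_tag_zero hk h]

theorem len_of_tag_one {k : ℕ} (hk : k < G.numVars) (h : G.tag k = 1) :
    G.len k = G.len (G.fst k) + G.len (G.snd k) := by
  simp [len, str_of_tag_one hk h]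

theorem len_pos {k : ℕ} (hk : k < G.numVars) : 0 < G.len k := by
  induction k using Nat.strong_induction_on with
  | _ k ih =>
    rcases tag_eq hk with h | h
    · simp [len_of_tag_zero hk h]
    · have := ih _ (fst_lt hk h) ((fst_lt hk h).trans hk)
      rw [len_of_tag_one hk h]
      omega

theorem str_last : G.str (G.numVars - 1) = G.word := by
  rw [str, dif_pos (Nat.sub_lt G.numVars_pos Nat.one_pos), word]

theorem two_mul_numVars_le_size : 2 * G.numVars ≤ G.size := by
  have : ∑ _k : Fin G.numVars, 2 ≤ G.size :=
    Finset.sum_le_sum fun k _ => by cases G.rule k <;> simp [SLPRule.symbols]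
  simpa [mul_comm] using this

variable (G)

/-! ### The number of occurrences of a variable in the derivation tree -/

/-- The number of occurrences of the variables, counting only the occurrences below the start
symbol and below the last `i` variables. -/
def occAux : ℕ → ℕ → ℕ
  | 0, z => if z = G.numVars - 1 then 1 else 0
  | i + 1, z =>
    if G.tag (G.numVars - 1 - i) = 1 then
      occAux i z + occAux i (G.numVars - 1 - i) *
        ((if z = G.fst (G.numVars - 1 - i) then 1 else 0) +
          (if z = G.snd (G.numVars - 1 - i) then 1 else 0))
    else occAux i z

/-- The number of occurrences of a variable in the derivation tree. -/
def occ (z : ℕ) : ℕ := G.occAux G.numVars z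

theorem occAux_mono (z : ℕ) : Monotone fun i => G.occAux i z :=
  monotone_nat_of_le_succ fun i => by
    change G.occAux i z ≤ G.occAux (i + 1) z
    rw [occAux]
    split <;> simp

/-- Only variables above `z` contribute to the count of `z`. Under the hypothesis they have all been
expanded after `i` steps, and later steps change only smaller variables. -/
theorem occAux_eq_occ {i z : ℕ} (hi : i ≤ G.numVars) (hz : G.numVars ≤ z + 1 + i) :
    G.occAux i z = G.occ z := by
  suffices ∀ j, i + j ≤ G.numVars → G.occAux (i + j) z = G.occAux i z by
    rw [occ, ← this (G.numVars - i) (by omega)]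
    congr 1
    omega
  intro j
  induction j with
  | zero => simp
  | succ j ih =>
    intro hj
    rw [← ih (by omega), ← add_assoc, occAux]
    split
    · next h =>
      have h1 := fst_lt (by omega) h
      have h2 := snd_lt (by omega) h
      rw [if_neg (by omega), if_neg (by omega)]
      simp
    · rfl

theorem occAux_le_occ {i : ℕ} (hi : i ≤ G.numVars) (z : ℕ) : G.occAux i z ≤ G.occ z :=
  G.occAux_mono z hi

variable {G}

theorem occAux_succ_eq {k : ℕ} (hk : k < G.numVars) (h : G.tag k = 1) (z : ℕ) :
    G.occAux (G.numVars - k) z = G.occAux (G.numVars - 1 - k) z +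
      G.occ k * ((if z = G.fst k then 1 else 0) + (if z = G.snd k then 1 else 0)) := by
  have h1 : G.numVars - k = (G.numVars - 1 - k) + 1 := by omega
  have h2 : G.numVars - 1 - (G.numVars - 1 - k) = k := by omega
  rw [h1, occAux, h2, if_pos h, G.occAux_eq_occ (z := k) (by omega) (by omega)]

/-- The variable `z` occurs in the rule of `k`. -/
def IsChild (G : SLP) (k z : ℕ) : Prop := G.tag k = 1 ∧ (z = G.fst k ∨ z = G.snd k)

theorem IsChild.lt {k z : ℕ} (hk : k < G.numVars) (h : G.IsChild k z) : z < k := by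
  rcases h with ⟨h, rfl | rfl⟩
  exacts [fst_lt hk h, snd_lt hk h]

theorem IsChild.le_occAux {k z : ℕ} (hk : k < G.numVars) (h : G.IsChild k z) :
    G.occAux (G.numVars - 1 - k) z + G.occ k ≤ G.occAux (G.numVars - k) z := by
  rw [occAux_succ_eq hk h.1]
  refine Nat.add_le_add_left ?_ _
  rcases h.2 with h | h <;> rw [if_pos h] <;>
    exact Nat.le_mul_of_pos_right _ (by split <;> omega)

theorem IsChild.occ_le {k z : ℕ} (hk : k < G.numVars) (h : G.IsChild k z) : G.occ k ≤ G.occ z :=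
  le_trans (by have := h.le_occAux hk; omega) (G.occAux_le_occ (Nat.sub_le _ k) z)

/-- The larger parent `k` is expanded before `j`, so both contributions are added to the count of
`z` at different steps. This is what makes predecessors on paths unique. -/
theorem IsChild.occ_add_occ_le {j k z : ℕ} (hk : k < G.numVars) (hjk : j < k)
    (h : G.IsChild k z) (h' : G.IsChild j z) : G.occ j + G.occ k ≤ G.occ z := by
  have h1 := h.le_occAux hk
  have h2 := h'.le_occAux (hjk.trans hk)
  have h3 := G.occAux_mono z (show G.numVars - k ≤ G.numVars - 1 - j by omega)
  have h4 := G.occAux_le_occ (Nat.sub_le _ j) z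
  simp only at h3
  omega

theorem occ_last_pos : 0 < G.occ (G.numVars - 1) :=
  lt_of_lt_of_le (by simp [occAux]) (G.occAux_mono (G.numVars - 1) (Nat.zero_le G.numVars))

/-- The sum is the length of a sentential form restricted to the variables not yet expanded.
Expanding a pair moves its length to its children; expanding a terminal drops its contribution. -/
theorem sum_occAux_mul_len_le (i : ℕ) (hi : i ≤ G.numVars) :
    ∑ z ∈ Finset.range (G.numVars - i), G.occAux i z * G.len z ≤ G.word.length := by
  induction i with
  | zero =>
    have h := G.numVars_pos
    simp only [occAux, ite_mul, one_mul, zero_mul, Finset.sum_ite_eq', Finset.mem_range]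
    rw [if_pos (by omega), len, str_last]
  | succ i ih =>
    have ih := ih (by omega)
    have h1 : G.numVars - i = (G.numVars - 1 - i) + 1 := by omega
    have h2 : G.numVars - (i + 1) = G.numVars - 1 - i := by omega
    rw [h1, Finset.sum_range_succ] at ih
    rw [h2]
    refine le_trans ?_ ih
    have hk : G.numVars - 1 - i < G.numVars := by omega
    rcases tag_eq hk with h | h
    · simp [occAux, h]
    · have e1 := fst_lt hk h
      have e2 := snd_lt hk h
      simp only [occAux, h, if_true, add_mul, mul_add, Finset.sum_add_distrib, mul_ite, mul_one,
        mul_zero, ite_mul, zero_mul, Finset.sum_ite_eq', Finset.mem_range, e1, e2,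
        len_of_tag_one hk h]
      exact le_rfl

theorem occAux_mul_len_le {k : ℕ} (i : ℕ) (hi : i + k < G.numVars) :
    G.occAux i k * G.len k ≤ G.word.length :=
  (Finset.single_le_sum (f := fun z => G.occAux i z * G.len z) (fun _ _ => Nat.zero_le _)
    (Finset.mem_range.2 (by omega))).trans (sum_occAux_mul_len_le i (by omega))

theorem occ_mul_len_le {k : ℕ} (hk : k < G.numVars) : G.occ k * G.len k ≤ G.word.length := by
  rw [← G.occAux_eq_occ (i := G.numVars - 1 - k) (by omega) (by omega)]
  exact occAux_mul_len_le _ (by omega)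

theorem occ_le {k : ℕ} (hk : k < G.numVars) : G.occ k ≤ G.word.length :=
  (Nat.le_mul_of_pos_right _ (len_pos hk)).trans (occ_mul_len_le hk)

/-- The variable occurs in the derivation tree. -/
def Reach (G : SLP) (k : ℕ) : Prop := k < G.numVars ∧ 0 < G.occ k

theorem Reach.len_le {k : ℕ} (h : G.Reach k) : G.len k ≤ G.word.length :=
  (Nat.le_mul_of_pos_left _ h.2).trans (occ_mul_len_le h.1)

theorem Reach.child {k z : ℕ} (h : G.Reach k) (hz : G.IsChild k z) : G.Reach z :=
  ⟨(hz.lt h.1).trans h.1, h.2.trans_le (hz.occ_le h.1)⟩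

theorem reach_last : G.Reach (G.numVars - 1) :=
  ⟨Nat.sub_lt G.numVars_pos Nat.one_pos, occ_last_pos⟩

/-! ### The symmetric centroid decomposition -/

/-- The rounded binary logarithm of the length. -/
def level (G : SLP) (k : ℕ) : ℕ := Nat.log 2 (G.len k)

/-- The child `z` of `k` that has the same level, and fewer than twice the occurrences. -/
def Heavy (G : SLP) (k z : ℕ) : Prop := G.level z = G.level k ∧ G.occ z < 2 * G.occ k

instance (k z : ℕ) : Decidable (G.Heavy k z) := by unfold Heavy; infer_instance

/-- The next variable on the path of the decomposition, plus one; `0` at the end of a path. -/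
def next (G : SLP) (k : ℕ) : ℕ :=
  if G.tag k = 1 then
    if G.Heavy k (G.fst k) then G.fst k + 1
    else if G.Heavy k (G.snd k) then G.snd k + 1 else 0
  else 0

theorem isChild_of_next {k u : ℕ} (h : G.next k = u + 1) : G.IsChild k u ∧ G.Heavy k u := by
  unfold next at h
  split at h
  · next ht =>
    split at h
    · next hh =>
      obtain rfl : u = G.fst k := by omega
      exact ⟨⟨ht, .inl rfl⟩, hh⟩
    · split at h
      · next hh =>
        obtain rfl : u = G.snd k := by omega
        exact ⟨⟨ht, .inr rfl⟩, hh⟩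
      · omega
  · omega

theorem two_pow_level_le {k : ℕ} (hk : k < G.numVars) : 2 ^ G.level k ≤ G.len k :=
  Nat.pow_log_le_self 2 (len_pos hk).ne'

theorem lt_two_pow_level (G : SLP) (k : ℕ) : G.len k < 2 ^ (G.level k + 1) :=
  Nat.lt_pow_succ_log_self (by norm_num) _

theorem len_child_le {k z : ℕ} (hk : k < G.numVars) (h : G.IsChild k z) : G.len z ≤ G.len k := by
  rw [len_of_tag_one hk h.1]
  rcases h.2 with rfl | rfl <;> omega

theorem level_child_le {k z : ℕ} (hk : k < G.numVars) (h : G.IsChild k z) :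
    G.level z ≤ G.level k :=
  Nat.log_mono_right (len_child_le hk h)

/-- Two children of length at least `2 ^ l` make a string of length at least `2 ^ (l + 1)`. -/
theorem not_both_level {k : ℕ} (hk : k < G.numVars) (h : G.tag k = 1)
    (h1 : G.level (G.fst k) = G.level k) (h2 : G.level (G.snd k) = G.level k) : False := by
  have e1 := two_pow_level_le ((fst_lt hk h).trans hk)
  have e2 := two_pow_level_le ((snd_lt hk h).trans hk)
  have e3 := G.lt_two_pow_level k
  rw [h1] at e1
  rw [h2] at e2
  rw [len_of_tag_one hk h, pow_succ] at e3
  omega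

/-- Hence comparing the next variable with the first child tells on which side the path continues,
which is how offsets are computed. -/
theorem fst_ne_snd_of_next {k u : ℕ} (hk : k < G.numVars) (h : G.next k = u + 1) :
    G.fst k ≠ G.snd k := by
  intro he
  obtain ⟨h1, h2⟩ := isChild_of_next h
  rcases h1.2 with rfl | rfl
  · exact not_both_level hk h1.1 h2.1 (he ▸ h2.1)
  · exact not_both_level hk h1.1 (he ▸ h2.1) h2.1

/-- With two predecessors, the count of `u` is at least the sum of theirs but less than twice each
of them, which is impossible. -/
theorem next_inj {j k u : ℕ} (hj : j < G.numVars) (hk : k < G.numVars) (h : G.next j = u + 1)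
    (h' : G.next k = u + 1) : j = k := by
  obtain ⟨h1, h2⟩ := isChild_of_next h
  obtain ⟨h3, h4⟩ := isChild_of_next h'
  have := h2.2
  have := h4.2
  by_contra hne
  rcases lt_or_gt_of_ne hne with hlt | hlt
  · have := h3.occ_add_occ_le hk hlt h1
    omega
  · have := h1.occ_add_occ_le hj hlt h3
    omega

theorem next_lt {k u : ℕ} (hk : k < G.numVars) (h : G.next k = u + 1) : u < k :=
  (isChild_of_next h).1.lt hk

theorem Reach.next {k u : ℕ} (hk : G.Reach k) (h : G.next k = u + 1) : G.Reach u :=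
  hk.child (isChild_of_next h).1

/-- If neither alternative holds, `z` qualifies for the path; then the path could only prefer the
first child over it, and both children would have the level of `k`. -/
theorem light_child {k z : ℕ} (hk : k < G.numVars) (h : G.IsChild k z) (hn : G.next k ≠ z + 1) :
    G.level z < G.level k ∨ 2 * G.occ k ≤ G.occ z := by
  by_contra! hc
  have hle := level_child_le hk h
  have hz : G.Heavy k z := ⟨by omega, by omega⟩
  unfold SLP.next at hn
  rw [if_pos h.1] at hn
  by_cases hf : G.Heavy k (G.fst k)
  · rw [if_pos hf] at hn
    rcases h.2 with h2 | h2
    · omega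
    · exact not_both_level hk h.1 hf.1 (h2 ▸ hz.1)
  · rw [if_neg hf] at hn
    rcases h.2 with h2 | h2
    · exact hf (h2 ▸ hz)
    · rw [if_pos (h2 ▸ hz)] at hn
      omega

/-- The length of the next variable on the path, or `0`. -/
def nextLen (G : SLP) (k : ℕ) : ℕ := if G.next k = 0 then 0 else G.len (G.next k - 1)

theorem nextLen_of_next {k u : ℕ} (h : G.next k = u + 1) : G.nextLen k = G.len u := by
  simp [nextLen, h]

theorem nextLen_of_next_eq_zero {k : ℕ} (h : G.next k = 0) : G.nextLen k = 0 := by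
  simp [nextLen, h]

theorem nextLen_lt {k : ℕ} (hk : k < G.numVars) : G.nextLen k < G.len k := by
  rcases hn : G.next k with _ | u
  · rw [nextLen_of_next_eq_zero hn]
    exact len_pos hk
  · rw [nextLen_of_next hn]
    have h := (isChild_of_next hn).1
    have h1 := len_pos ((fst_lt hk h.1).trans hk)
    have h2 := len_pos ((snd_lt hk h.1).trans hk)
    rw [len_of_tag_one hk h.1]
    rcases h.2 with rfl | rfl <;> omega

/-- The number of variables on the path from the given variable on. -/
def pathLen (G : SLP) (k : ℕ) : ℕ :=
  -- The second condition serves termination only; by `next_lt` it holds for every actual variable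
  -- that has a successor.
  if h : G.next k ≠ 0 ∧ G.next k - 1 < k then pathLen G (G.next k - 1) + 1 else 1
termination_by k
decreasing_by exact h.2

theorem pathLen_of_next {k u : ℕ} (hk : k < G.numVars) (h : G.next k = u + 1) :
    G.pathLen k = G.pathLen u + 1 := by
  have := next_lt hk h
  rw [pathLen, dif_pos (by simp [h, this])]
  simp [h]

theorem pathLen_of_next_eq_zero {k : ℕ} (h : G.next k = 0) : G.pathLen k = 1 := by
  rw [pathLen, dif_neg (by simp [h])]

theorem pathLen_pos (k : ℕ) : 0 < G.pathLen k := by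
  rw [pathLen]
  split <;> omega

/-- The variable is not the first one of its path. -/
def Inner (G : SLP) (k u : ℕ) : Prop := ∃ p, k ≤ p ∧ G.Reach p ∧ G.next p = u + 1

-- The length of a path from `k` is one plus the length from its successor. Summed over all
-- variables that occur, the successor terms are exactly those of the inner variables, by
-- `next_inj`, and cancel; one unit per variable remains.
open Classical in
theorem sum_pathLen_le : ∑ k ∈ (Finset.range G.numVars).filter
    (fun k => G.Reach k ∧ ¬ G.Inner 0 k), G.pathLen k ≤ G.numVars := by
  set R := (Finset.range G.numVars).filter G.Reach with hR
  have hmem : ∀ k, k ∈ R ↔ G.Reach k := fun k => by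
    simp only [hR, Finset.mem_filter, Finset.mem_range]
    exact ⟨fun h => h.2, fun h => ⟨h.1, h⟩⟩
  have h1 : ∑ k ∈ R, G.pathLen k = R.card +
      ∑ k ∈ R.filter (fun k => G.next k ≠ 0), G.pathLen (G.next k - 1) := by
    rw [Finset.sum_filter (p := fun k => G.next k ≠ 0), Finset.card_eq_sum_ones,
      ← Finset.sum_add_distrib]
    refine Finset.sum_congr rfl fun k hk => ?_
    rcases hn : G.next k with _ | u
    · simp [pathLen_of_next_eq_zero hn]
    · simp [pathLen_of_next ((hmem k).1 hk).1 hn, add_comm]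
  have h2 : ∑ k ∈ R.filter (fun k => G.next k ≠ 0), G.pathLen (G.next k - 1) =
      ∑ u ∈ R.filter (fun u => G.Inner 0 u), G.pathLen u := by
    refine Finset.sum_bij (fun k _ => G.next k - 1) ?_ ?_ ?_ fun _ _ => rfl
    · intro k hk
      simp only [Finset.mem_filter, hmem] at hk ⊢
      have : G.next k = (G.next k - 1) + 1 := by omega
      exact ⟨hk.1.next this, k, Nat.zero_le _, hk.1, this⟩
    · intro j hj k hk h
      simp only [Finset.mem_filter, hmem] at hj hk
      exact next_inj (u := G.next j - 1) hj.1.1 hk.1.1 (by omega) (by omega)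
    · intro u hu
      simp only [Finset.mem_filter, hmem] at hu ⊢
      obtain ⟨k, -, hk, h⟩ := hu.2
      exact ⟨k, ⟨hk, by omega⟩, by simp [h]⟩
  have h3 := Finset.sum_filter_add_sum_filter_not R (fun u => G.Inner 0 u) G.pathLen
  have h4 : R.card ≤ G.numVars := (Finset.card_filter_le _ _).trans (by simp)
  rw [hR, Finset.filter_filter] at h3
  rw [hR] at h1 h2 h4
  simp only [Finset.filter_filter] at h1 h2 h3 ⊢
  omega

end SLP

/-! ### Programs, memory invariants and their verification -/

namespace SLP

open WordRAM Expr

variable {G : SLP} {w : ℕ}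

/-- Words are large enough for the numbers that occur in the computation. -/
def Roomy (G : SLP) (w : ℕ) : Prop := 51 * G.numVars + 4 * G.word.length + 16 < 2 ^ w

/-- The content of the field `f` of the record `k`. -/
def field (G : SLP) (mem : ℕ → ℕ) (f k : ℕ) : ℕ := mem (fieldAddr G.numVars f k)

/-- The input is in its place. -/
def HasInput (G : SLP) (mem : ℕ → ℕ) : Prop := ∀ a < 3 * G.numVars, mem a = G.inputMem a

theorem Roomy.fieldAddr_lt (hw : G.Roomy w) {f k : ℕ} (hk : k < 3 * G.numVars) (hf : f < 16) :
    fieldAddr G.numVars f k < 2 ^ w :=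
  (WordRAM.fieldAddr_lt hk hf).trans (by unfold Roomy at hw; omega)

theorem field_update (mem : ℕ → ℕ) {f f' : ℕ} (hf : f < 16) (hf' : f' < 16) (k k' v : ℕ) :
    G.field (Function.update mem (fieldAddr G.numVars f' k') v) f k =
      if k = k' ∧ f = f' then v else G.field mem f k := by
  simp only [field, Function.update_apply, fieldAddr_inj hf hf']

theorem HasInput.update {mem : ℕ → ℕ} (h : G.HasInput mem) (f k v : ℕ) :
    G.HasInput (Function.update mem (fieldAddr G.numVars f k) v) := fun a ha => by
  rw [Function.update_of_ne (ne_fieldAddr ha f k), h a ha]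

theorem HasInput.tag {mem : ℕ → ℕ} (h : G.HasInput mem) {k : ℕ} (hk : k < G.numVars) :
    mem (3 * k) = G.tag k := h _ (by omega)

theorem HasInput.fst {mem : ℕ → ℕ} (h : G.HasInput mem) {k : ℕ} (hk : k < G.numVars) :
    mem (3 * k + 1) = G.fst k := h _ (by omega)

theorem HasInput.snd {mem : ℕ → ℕ} (h : G.HasInput mem) {k : ℕ} (hk : k < G.numVars) :
    mem (3 * k + 2) = G.snd k := h _ (by omega)

/-! ### Counting the occurrences -/

/-- One step of the counting: the occurrences of `k` are added to those of its children. -/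
def countBody : Prog :=
  block [
    .assign 1 (reg 1 - const 1),
    .ite (load (const 3 * reg 1))
      (block [
        .assign 2 (load (const 3 * reg 1 + const 1)),
        .store (addrExpr 0 (reg 2)) (fieldExpr 0 (reg 2) + fieldExpr 0 (reg 1)),
        .assign 2 (load (const 3 * reg 1 + const 2)),
        .store (addrExpr 0 (reg 2)) (fieldExpr 0 (reg 2) + fieldExpr 0 (reg 1))])
      .skip]

/-- The program that counts the occurrences of the variables. -/
def countProg : Prog :=
  block [
    .store (addrExpr 0 (reg 0 - const 1)) (const 1),
    .assign 1 (reg 0),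
    .while (reg 1) countBody]

/-- The state before the step of `countProg` for the variable `k - 1`. -/
structure CountInv (G : SLP) (k : ℕ) (σ : State) : Prop where
  le : k ≤ G.numVars
  reg0 : σ.reg 0 = G.numVars
  reg1 : σ.reg 1 = k
  input : G.HasInput σ.mem
  count : ∀ z < G.numVars, G.field σ.mem 0 z = G.occAux (G.numVars - k) z

theorem countBody_spec (hw : G.Roomy w) {k : ℕ} {σ : State} (h : G.CountInv (k + 1) σ) :
    WP w (51 * G.numVars) countBody σ 0 fun t τ => t ≤ 100 ∧ G.CountInv k τ := by
  obtain ⟨h1, h2, h3, h4, h5⟩ := h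
  have hk : k < G.numVars := h1
  have hw' := hw
  unfold Roomy at hw'
  have e0 := h4.tag hk
  have e1 := h4.fst hk
  have e2 := h4.snd hk
  have e3 : G.numVars - (k + 1) = G.numVars - 1 - k := by omega
  rw [e3] at h5
  -- All parents of `k` have larger indices, so the stored count of `k` is already final.
  have e4 : G.occAux (G.numVars - 1 - k) k = G.occ k := G.occAux_eq_occ (by omega) (by omega)
  rcases tag_eq hk with ht | ht
  · have hocc : G.occAux (G.numVars - k) = G.occAux (G.numVars - 1 - k) := by
      have : G.numVars - k = (G.numVars - 1 - k) + 1 := by omega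
      have h' : G.numVars - 1 - (G.numVars - 1 - k) = k := by omega
      funext z
      rw [this, occAux, h', if_neg (by omega)]
    simp [countBody, block, Function.update_apply, h2, h3, e0, ht]
    refine ⟨by omega, ⟨by omega, by simp [h2], by simp, h4, by rwa [hocc]⟩⟩
  · have l1 := fst_lt hk ht
    have l2 := snd_lt hk ht
    have c0 : σ.mem (fieldAddr G.numVars 0 k) = _ := h5 k hk
    have c1 : σ.mem (fieldAddr G.numVars 0 (G.fst k)) = _ := h5 _ (l1.trans hk)
    have c2 : σ.mem (fieldAddr G.numVars 0 (G.snd k)) = _ := h5 _ (l2.trans hk)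
    have o1 := fun z => occAux_succ_eq hk ht z
    have b1 := (G.occAux_le_occ (Nat.sub_le _ k) (G.fst k)).trans (occ_le (l1.trans hk))
    have b2 := (G.occAux_le_occ (Nat.sub_le _ k) (G.snd k)).trans (occ_le (l2.trans hk))
    rw [o1] at b1 b2
    simp at b1 b2
    have i2 : 3 * k + 2 < 3 * G.numVars := by omega
    have i3 : k < 3 * G.numVars := by omega
    have i4 : G.fst k < 3 * G.numVars := by omega
    have i5 : G.snd k < 3 * G.numVars := by omega
    simp [countBody, block, Function.update_apply, h2, h3, e0, e1, e2, ht, c0, c1, c2,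
      fieldAddr_inj, l1.ne', WordRAM.fieldAddr_lt, hw.fieldAddr_lt, ne_fieldAddr, i2,
      i3, i4, i5]
    rw [e4]
    refine ⟨by omega, by omega, ?_, by omega, ?_, by omega, by simp [h2], by simp,
      (h4.update _ _ _).update _ _ _, fun z hz => ?_⟩
    · split at b1 <;> omega
    · split <;> simp_all <;> omega
    · have := h5 z hz
      rw [o1]
      simp only [field_update _ (show 0 < 16 by decide) (show 0 < 16 by decide), and_true, this]
      split <;> split <;> simp_all
      omega

theorem countProg_spec (hw : G.Roomy w) {σ : State} (h0 : σ.reg 0 = G.numVars)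
    (hmem : σ.mem = G.inputMem) (t : ℕ) :
    WP w (51 * G.numVars) countProg σ t fun t' τ =>
      t' ≤ t + 110 * G.numVars + 30 ∧ G.CountInv 0 τ := by
  have hm := G.numVars_pos
  have hw' := hw
  unfold Roomy at hw'
  have i1 : G.numVars - 1 < 3 * G.numVars := by omega
  simp [countProg, block, h0, WordRAM.fieldAddr_lt, hw.fieldAddr_lt, i1]
  refine WP.while (w := w) (by omega) 100 G.CountInv (fun _ _ _ => safe_reg ..) ?_ G.numVars ?_ ?_
  · intro n τ hI hc
    obtain _ | k := n
    · exact absurd hI.reg1 hc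
    · exact ⟨k, rfl, countBody_spec hw hI⟩
  · refine ⟨le_rfl, by simp [h0], by simp, ?_, fun z hz => ?_⟩
    · rw [hmem]
      exact HasInput.update (fun _ _ => rfl) _ _ _
    · simp only [field_update _ (show 0 < 16 by decide) (show 0 < 16 by decide), and_true, hmem,
        Nat.sub_self, occAux]
      split
      · rfl
      · rw [field, inputMem, dif_neg]
        unfold fieldAddr
        omega
  · intro t' n τ ht hI hc
    have : n = 0 := by
      rw [← hI.reg1]
      exact hc
    subst this
    simp at ht
    exact ⟨by omega, hI⟩

/-! ### Lengths and paths -/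

/-- `M` is the larger of the two powers of two, written with truncated subtraction. The length of
`k` lies between `M` and `4 * M`, so one comparison with `2 * M` decides whether the level rises by
one. No logarithm has to be computed. -/
theorem level_eq_of_pair {k : ℕ} (hk : k < G.numVars) (h : G.tag k = 1) {M : ℕ}
    (hM : M = 2 ^ G.level (G.fst k) + (2 ^ G.level (G.snd k) - 2 ^ G.level (G.fst k))) :
    2 ^ G.level k = M + M * (1 - if G.len k < M + M then 1 else 0) := by
  have h1 := two_pow_level_le ((fst_lt hk h).trans hk)
  have h2 := two_pow_level_le ((snd_lt hk h).trans hk)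
  have h3 := G.lt_two_pow_level (G.fst k)
  have h4 := G.lt_two_pow_level (G.snd k)
  have h5 := len_of_tag_one hk h
  rw [pow_succ] at h3 h4
  obtain ⟨L, hL⟩ : ∃ L, M = 2 ^ L := by
    rcases le_total (2 ^ G.level (G.fst k)) (2 ^ G.level (G.snd k)) with hle | hle
    · exact ⟨G.level (G.snd k), by omega⟩
    · exact ⟨G.level (G.fst k), by omega⟩
  split
  · have : G.level k = L := Nat.log_eq_of_pow_le_of_lt_pow (by omega) (by rw [pow_succ]; omega)
    simp [this, hL]
  · have : G.level k = L + 1 :=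
      Nat.log_eq_of_pow_le_of_lt_pow (by rw [pow_succ]; omega) (by rw [pow_succ, pow_succ]; omega)
    rw [this, hL, pow_succ]
    omega

/-- The computation of the length, the power of two for the level, and the successor on the path
of a variable with a pair of children. -/
def pairBlock : Prog :=
  block [
    .assign 2 (load (const 3 * reg 1 + const 1)),
    .assign 3 (load (const 3 * reg 1 + const 2)),
    .assign 6 (fieldExpr 1 (reg 2) + fieldExpr 1 (reg 3)),
    .assign 4 (fieldExpr 2 (reg 2) + (fieldExpr 2 (reg 3) - fieldExpr 2 (reg 2))),
    .assign 4 (reg 4 + reg 4 * (const 1 - .op .lt (reg 6) (reg 4 + reg 4))),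
    .assign 5 (const 0),
    .ite (.op .eq (fieldExpr 2 (reg 2)) (reg 4) *
        .op .lt (fieldExpr 0 (reg 2)) (fieldExpr 0 (reg 1) + fieldExpr 0 (reg 1)))
      (.assign 5 (reg 2 + const 1))
      (.ite (.op .eq (fieldExpr 2 (reg 3)) (reg 4) *
          .op .lt (fieldExpr 0 (reg 3)) (fieldExpr 0 (reg 1) + fieldExpr 0 (reg 1)))
        (.assign 5 (reg 3 + const 1))
        .skip)]

/-- The same for a variable with a terminal symbol. -/
def terminalBlock : Prog :=
  block [
    .assign 6 (const 1),
    .assign 4 (const 1),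
    .assign 5 (const 0)]

/-- The program that stores the results of `pairBlock`. -/
def storeBlock : Prog :=
  block [
    .store (addrExpr 1 (reg 1)) (reg 6),
    .store (addrExpr 2 (reg 1)) (reg 4),
    .store (addrExpr 3 (reg 1)) (reg 5),
    -- The flag for having a predecessor is cleared here. A predecessor has a larger index, so it is
    -- processed later and can then set the flag.
    .store (addrExpr 6 (reg 1)) (const 0),
    .ite (reg 5)
      (block [
        .store (addrExpr 4 (reg 1)) (fieldExpr 1 (reg 5 - const 1)),
        .store (addrExpr 5 (reg 1)) (fieldExpr 5 (reg 5 - const 1) + const 1),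
        .store (addrExpr 6 (reg 5 - const 1)) (const 1)])
      (block [
        .store (addrExpr 4 (reg 1)) (const 0),
        .store (addrExpr 5 (reg 1)) (const 1)])]

/-- The test of the count skips variables outside the derivation tree: their lengths are not bounded
by N and might not fit into a word. -/
def fillBody : Prog :=
  block [
    .ite (fieldExpr 0 (reg 1))
      (.seq (.ite (load (const 3 * reg 1)) pairBlock terminalBlock) storeBlock)
      .skip,
    .assign 1 (reg 1 + const 1)]

/-- The program that computes the lengths and the paths. -/
def fillProg : Prog :=
  .seq (.assign 1 (const 0)) (.while (.op .lt (reg 1) (reg 0)) fillBody)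

/-- The memory after the computation of lengths and paths for the first `k` variables. -/
structure Filled (G : SLP) (k : ℕ) (mem : ℕ → ℕ) : Prop where
  input : G.HasInput mem
  count : ∀ z < G.numVars, G.field mem 0 z = G.occ z
  len : ∀ z < k, G.Reach z → G.field mem 1 z = G.len z
  pow : ∀ z < k, G.Reach z → G.field mem 2 z = 2 ^ G.level z
  next : ∀ z < k, G.Reach z → G.field mem 3 z = G.next z
  nextLen : ∀ z < k, G.Reach z → G.field mem 4 z = G.nextLen z
  pathLen : ∀ z < k, G.Reach z → G.field mem 5 z = G.pathLen z
  inner : ∀ z < k, G.Reach z → (∃ p < k, G.Reach p ∧ G.next p = z + 1) → G.field mem 6 z = 1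
  notInner : ∀ z < k, G.Reach z → (¬∃ p < k, G.Reach p ∧ G.next p = z + 1) → G.field mem 6 z = 0

/-- The values that `storeBlock` stores. -/
structure Computed (G : SLP) (k : ℕ) (mem : ℕ → ℕ) (σ : State) : Prop where
  reg0 : σ.reg 0 = G.numVars
  reg1 : σ.reg 1 = k
  reg4 : σ.reg 4 = 2 ^ G.level k
  reg5 : σ.reg 5 = G.next k
  reg6 : σ.reg 6 = G.len k
  mem_eq : σ.mem = mem

theorem terminalBlock_spec {k : ℕ} (hk : k < G.numVars) (ht : G.tag k = 0) {σ : State}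
    (h0 : σ.reg 0 = G.numVars) (h1 : σ.reg 1 = k) (t s : ℕ) :
    WP w s terminalBlock σ t fun t' τ => t' ≤ t + 10 ∧ Computed G k σ.mem τ := by
  have hl := len_of_tag_zero hk ht
  simp [terminalBlock, block]
  exact ⟨by simp [h0], by simp [h1], by simp [level, hl], by simp [SLP.next, ht], by simp [hl], rfl⟩

theorem pairBlock_spec (hw : G.Roomy w) {k : ℕ} (hk : G.Reach k) (ht : G.tag k = 1) {σ : State}
    (h0 : σ.reg 0 = G.numVars) (h1 : σ.reg 1 = k) (hf : G.Filled k σ.mem) (t : ℕ) :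
    WP w (51 * G.numVars) pairBlock σ t fun t' τ => t' ≤ t + 250 ∧ Computed G k σ.mem τ := by
  have hw' := hw
  unfold Roomy at hw'
  have l1 := fst_lt hk.1 ht
  have l2 := snd_lt hk.1 ht
  have r1 : G.Reach (G.fst k) := hk.child ⟨ht, .inl rfl⟩
  have r2 : G.Reach (G.snd k) := hk.child ⟨ht, .inr rfl⟩
  have e1 := hf.input.fst hk.1
  have e2 := hf.input.snd hk.1
  have c0 : σ.mem (fieldAddr G.numVars 0 k) = _ := hf.count _ hk.1
  have c1 : σ.mem (fieldAddr G.numVars 0 (G.fst k)) = _ := hf.count _ r1.1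
  have c2 : σ.mem (fieldAddr G.numVars 0 (G.snd k)) = _ := hf.count _ r2.1
  have n1 : σ.mem (fieldAddr G.numVars 1 (G.fst k)) = _ := hf.len _ l1 r1
  have n2 : σ.mem (fieldAddr G.numVars 1 (G.snd k)) = _ := hf.len _ l2 r2
  have p1 : σ.mem (fieldAddr G.numVars 2 (G.fst k)) = _ := hf.pow _ l1 r1
  have p2 : σ.mem (fieldAddr G.numVars 2 (G.snd k)) = _ := hf.pow _ l2 r2
  have i3 : k < 3 * G.numVars := by have := hk.1; omega
  have i4 : G.fst k < 3 * G.numVars := by omega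
  have i5 : G.snd k < 3 * G.numVars := by omega
  have b1 := occ_le hk.1
  have b2 := hk.len_le
  have hL := len_of_tag_one hk.1 ht
  obtain ⟨M, hM⟩ : ∃ M, M =
    2 ^ G.level (G.fst k) + (2 ^ G.level (G.snd k) - 2 ^ G.level (G.fst k)) := ⟨_, rfl⟩
  have hP := level_eq_of_pair hk.1 ht hM
  have q1 := two_pow_level_le r1.1
  have q2 := two_pow_level_le r2.1
  have hkey : ∀ z, (2 ^ G.level z = 2 ^ G.level k ↔ G.level z = G.level k) := fun z =>
    (Nat.pow_right_injective le_rfl).eq_iff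
  have q3 : M * (1 - if G.len k < M + M then 1 else 0) ≤ M := by split <;> simp
  simp [pairBlock, block, h0, h1, e1, e2, c0, c1, c2, n1, n2, p1, p2,
    WordRAM.fieldAddr_lt, hw.fieldAddr_lt, i3, i4, i5, ← hM, ← hL, ← hP, hkey]
  refine ⟨by omega, by omega, by omega, by omega, by omega, ⟨by omega, by split_ifs <;> omega⟩,
    fun h h' => ⟨by omega, ?_⟩, fun h => ⟨⟨by omega, by split_ifs <;> omega⟩,
      fun h' h'' => ⟨by omega, ?_⟩, fun h' => ?_⟩⟩
  · exact ⟨by simp [h0], by simp [h1], by simp, by simp [SLP.next, ht, Heavy, h, h', two_mul],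
      by simp, rfl⟩
  · have h1' : ¬G.Heavy k (G.fst k) := fun hh => by have := hh.1; have := hh.2; omega
    have h2' : G.Heavy k (G.snd k) := ⟨h', by omega⟩
    exact ⟨by simp [h0], by simp [h1], by simp, by simp [SLP.next, ht, h1', h2'], by simp, rfl⟩
  · have h1' : ¬G.Heavy k (G.fst k) := fun hh => by have := hh.1; have := hh.2; omega
    have h2' : ¬G.Heavy k (G.snd k) := fun hh => by have := hh.1; have := hh.2; omega
    exact ⟨by simp [h0], by simp [h1], by simp, by simp [SLP.next, ht, h1', h2'], by simp, rfl⟩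

theorem pathLen_le {k : ℕ} (hk : k < G.numVars) : G.pathLen k ≤ k + 1 := by
  induction k using Nat.strong_induction_on with
  | _ k ih =>
    rcases hn : G.next k with _ | u
    · rw [pathLen_of_next_eq_zero hn]
      omega
    · have hu := next_lt hk hn
      have := ih u hu (hu.trans hk)
      rw [pathLen_of_next hk hn]
      omega

/-- Apart from the record of `k`, only the predecessor flag of the successor of `k` may change. The
flag of `k` itself is 0, since no predecessor of `k` has been processed. -/
theorem Filled.succ {k : ℕ} {mem mem' : ℕ → ℕ} (hf : G.Filled k mem) (hk : G.Reach k)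
    (hinput : G.HasInput mem') (hz : ∀ z, G.field mem' 0 z = G.field mem 0 z)
    (h : ∀ f z, f < 6 → z ≠ k → G.field mem' f z = G.field mem f z)
    (h1 : G.field mem' 1 k = G.len k) (h2 : G.field mem' 2 k = 2 ^ G.level k)
    (h3 : G.field mem' 3 k = G.next k) (h4 : G.field mem' 4 k = G.nextLen k)
    (h5 : G.field mem' 5 k = G.pathLen k) (h6 : G.field mem' 6 k = 0)
    (h7 : ∀ z < k, G.field mem' 6 z = if G.next k = z + 1 then 1 else G.field mem 6 z) :
    G.Filled (k + 1) mem' := by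
  have hin : ∀ z, (∃ p < k + 1, G.Reach p ∧ G.next p = z + 1) ↔
      (∃ p < k, G.Reach p ∧ G.next p = z + 1) ∨ G.next k = z + 1 := by
    intro z
    constructor
    · rintro ⟨p, hp, hp', hpz⟩
      rcases Nat.lt_succ_iff_lt_or_eq.1 hp with hlt | rfl
      exacts [.inl ⟨p, hlt, hp', hpz⟩, .inr hpz]
    · rintro (⟨p, hp, hpz⟩ | hpz)
      exacts [⟨p, by omega, hpz⟩, ⟨k, by omega, hk, hpz⟩]
  have hnot : ¬∃ p < k + 1, G.Reach p ∧ G.next p = k + 1 := by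
    rintro ⟨p, hp, hr, h⟩
    have := next_lt hr.1 h
    omega
  refine ⟨hinput, fun z hzm => (hz z).trans (hf.count z hzm), fun z hzk hr => ?_,
    fun z hzk hr => ?_, fun z hzk hr => ?_, fun z hzk hr => ?_, fun z hzk hr => ?_,
    fun z hzk hr => ?_, fun z hzk hr => ?_⟩
  all_goals rcases Nat.lt_succ_iff_lt_or_eq.1 hzk with hzk | rfl
  · rw [h 1 z (by decide) hzk.ne, hf.len z hzk hr]
  · exact h1
  · rw [h 2 z (by decide) hzk.ne, hf.pow z hzk hr]
  · exact h2
  · rw [h 3 z (by decide) hzk.ne, hf.next z hzk hr]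
  · exact h3
  · rw [h 4 z (by decide) hzk.ne, hf.nextLen z hzk hr]
  · exact h4
  · rw [h 5 z (by decide) hzk.ne, hf.pathLen z hzk hr]
  · exact h5
  · rw [hin, h7 z hzk]
    intro hp
    split
    · rfl
    · next hne => exact hf.inner z hzk hr (hp.resolve_right hne)
  · exact fun hp => absurd hp hnot
  · rw [hin, h7 z hzk, not_or]
    intro hp
    rw [if_neg hp.2]
    exact hf.notInner z hzk hr hp.1
  · exact fun _ => h6

theorem storeBlock_spec (hw : G.Roomy w) {k : ℕ} (hk : G.Reach k) {σ : State} {mem : ℕ → ℕ}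
    (hσ : G.Computed k mem σ) (hf : G.Filled k mem) (t : ℕ) :
    WP w (51 * G.numVars) storeBlock σ t fun t' τ => t' ≤ t + 150 ∧
      τ.reg 0 = G.numVars ∧ τ.reg 1 = k ∧ G.Filled (k + 1) τ.mem := by
  obtain ⟨h0, h1, h4, h5, h6, rfl⟩ := hσ
  have hw' := hw
  unfold Roomy at hw'
  have i3 : k < 3 * G.numVars := by have := hk.1; omega
  rcases hn : G.next k with _ | u
  · simp [storeBlock, block, h0, h1, h4, h5, h6, hn, WordRAM.fieldAddr_lt, hw.fieldAddr_lt, i3]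
    apply hf.succ hk (((((((hf.input.update _ _ _).update _ _ _).update _ _ _).update _ _ _).update
      _ _ _).update _ _ _))
    · simp [field_update]
    · intro f z hf6 hz
      simp [field_update, hz, show f < 16 by omega]
    · simp [field_update]
    · simp [field_update]
    · simp [field_update, hn]
    · simp [field_update, nextLen_of_next_eq_zero hn]
    · simp [field_update, pathLen_of_next_eq_zero hn]
    · simp [field_update]
    · intro z hz
      simp [field_update, hz.ne, hn]
  · have hu := next_lt hk.1 hn
    have hru := hk.next hn
    have i4 : u < 3 * G.numVars := by omega
    have n1 : σ.mem (fieldAddr G.numVars 1 u) = _ := hf.len _ hu hru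
    have n2 : σ.mem (fieldAddr G.numVars 5 u) = _ := hf.pathLen _ hu hru
    have hpl := pathLen_of_next hk.1 hn
    have := pathLen_le hk.1
    simp [storeBlock, block, fieldAddr_inj, h0, h1, h4, h5, h6, hn,
      WordRAM.fieldAddr_lt, hw.fieldAddr_lt, i3, i4, hu.ne, n1, n2]
    refine ⟨by omega, ?_⟩
    apply hf.succ hk ((((((((hf.input.update _ _ _).update _ _ _).update _ _ _).update _ _ _).update
      _ _ _).update _ _ _).update _ _ _))
    · simp [field_update]
    · intro f z hf6 hz
      simp [field_update, hz, show f < 16 by omega, show f ≠ 6 by omega]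
    · simp [field_update]
    · simp [field_update]
    · simp [field_update, hn]
    · simp [field_update, nextLen_of_next hn]
    · simp [field_update, hpl]
    · simp [field_update, hu.ne']
    · intro z hz
      simp [field_update, hz.ne, hn, eq_comm]

theorem Filled.succ_of_not_reach {k : ℕ} {mem : ℕ → ℕ} (hf : G.Filled k mem) (hk : ¬G.Reach k) :
    G.Filled (k + 1) mem := by
  have hlt : ∀ z < k + 1, G.Reach z → z < k := fun z hz hr =>
    (Nat.lt_succ_iff_lt_or_eq.1 hz).resolve_right fun h => hk (h ▸ hr)
  exact ⟨hf.input, hf.count, fun z hz hr => hf.len z (hlt z hz hr) hr,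
    fun z hz hr => hf.pow z (hlt z hz hr) hr, fun z hz hr => hf.next z (hlt z hz hr) hr,
    fun z hz hr => hf.nextLen z (hlt z hz hr) hr, fun z hz hr => hf.pathLen z (hlt z hz hr) hr,
    fun z hz hr ⟨p, hp, hp', h⟩ => hf.inner z (hlt z hz hr) hr ⟨p, hlt p hp hp', hp', h⟩,
    fun z hz hr h => hf.notInner z (hlt z hz hr) hr
      fun ⟨p, hp, hp'⟩ => h ⟨p, by omega, hp'⟩⟩

/-- The state before the step of `fillProg` for the variable `k`. -/
structure FillInv (G : SLP) (k : ℕ) (σ : State) : Prop where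
  le : k ≤ G.numVars
  reg0 : σ.reg 0 = G.numVars
  reg1 : σ.reg 1 = k
  filled : G.Filled k σ.mem

theorem fillBody_spec (hw : G.Roomy w) {k : ℕ} (hk : k < G.numVars) {σ : State}
    (h : G.FillInv k σ) :
    WP w (51 * G.numVars) fillBody σ 0 fun t τ => t ≤ 500 ∧ G.FillInv (k + 1) τ := by
  obtain ⟨-, h0, h1, hf⟩ := h
  have hw' := hw
  unfold Roomy at hw'
  have i3 : k < 3 * G.numVars := by omega
  have c0 : σ.mem (fieldAddr G.numVars 0 k) = _ := hf.count _ hk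
  have e0 := hf.input.tag hk
  simp only [fillBody, block, wp_seq]
  refine WP.mono (Q := fun t τ => t ≤ 480 ∧ τ.reg 0 = G.numVars ∧ τ.reg 1 = k ∧
    G.Filled (k + 1) τ.mem) ?_ ?_
  · by_cases hr : G.Reach k
    · have hne := hr.2.ne'
      rcases tag_eq hk with ht | ht
      · simp [h0, h1, c0, hne, e0, ht, WordRAM.fieldAddr_lt, hw.fieldAddr_lt, i3]
        refine ⟨by omega, (terminalBlock_spec hk ht h0 h1 _ _).mono fun t τ hτ =>
          (storeBlock_spec hw hr hτ.2 hf _).mono fun t' υ hυ => ⟨?_, hυ.2⟩⟩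
        have := hτ.1
        have := hυ.1
        omega
      · simp [h0, h1, c0, hne, e0, ht, WordRAM.fieldAddr_lt, hw.fieldAddr_lt, i3]
        refine ⟨by omega, (pairBlock_spec hw hr ht h0 h1 hf _).mono fun t τ hτ =>
          (storeBlock_spec hw hr hτ.2 hf _).mono fun t' υ hυ => ⟨?_, hυ.2⟩⟩
        have := hτ.1
        have := hυ.1
        omega
    · have hne : G.occ k = 0 := by
        by_contra hne
        exact hr ⟨hk, Nat.pos_of_ne_zero hne⟩
      simp [h0, h1, c0, hne, WordRAM.fieldAddr_lt, hw.fieldAddr_lt, i3]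
      exact hf.succ_of_not_reach hr
  · rintro t τ ⟨ht, g0, g1, hf'⟩
    simp [g1]
    exact ⟨by omega, by omega, by omega, by simp [g0], by simp, hf'⟩

theorem fillProg_spec (hw : G.Roomy w) {σ : State} (h : G.CountInv 0 σ) (t : ℕ) :
    WP w (51 * G.numVars) fillProg σ t fun t' τ =>
      t' ≤ t + 510 * G.numVars + 20 ∧ τ.reg 0 = G.numVars ∧ G.Filled G.numVars τ.mem := by
  have hw' := hw
  unfold Roomy at hw'
  simp only [fillProg, wp_seq, wp_assign, safe_const, eval_const, cost_const]
  refine ⟨by decide, ?_⟩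
  refine WP.while (w := w) (by omega) 500 (fun n τ => n ≤ G.numVars ∧ G.FillInv (G.numVars - n) τ)
    (fun _ _ _ => by simp) ?_ G.numVars ⟨le_rfl, ?_⟩ ?_
  · rintro n τ ⟨hn, hI⟩ hc
    rw [eval_lt] at hc
    have hlt : τ.reg 1 < τ.reg 0 := by
      by_contra hlt
      exact hc (if_neg hlt)
    rw [hI.reg0, hI.reg1] at hlt
    refine ⟨n - 1, by omega, (fillBody_spec hw hlt hI).mono fun t τ hτ => ⟨hτ.1, by omega, ?_⟩⟩
    convert hτ.2 using 1
    omega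
  · rw [Nat.sub_self]
    have hz : ∀ z < 0, G.Reach z → False := fun z hz => absurd hz (Nat.not_lt_zero z)
    refine ⟨by omega, by simp [h.reg0], by simp, h.input, fun z hz => h.count z hz,
      fun z hz => ?_, fun z hz => ?_, fun z hz => ?_, fun z hz => ?_, fun z hz => ?_,
      fun z hz => ?_, fun z hz => ?_⟩ <;> omega
  · rintro t' n τ ht ⟨hn, hI⟩ hc
    rw [eval_lt, eval_reg, eval_reg, hI.reg0, hI.reg1] at hc
    have : ¬G.numVars - n < G.numVars := fun h => by simp [h] at hc
    have hn0 : G.numVars - n = G.numVars := by omega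
    rw [hn0] at hI
    simp at ht
    exact ⟨by omega, hI.reg0, hI.filled⟩

/-! ### The layout of the paths -/

/-- The allocation of positions and of a root task for the path that starts with the variable. -/
def topBlock : Prog :=
  block [
    .store (addrExpr 7 (reg 1)) (reg 2),
    .store (addrExpr 8 (reg 1)) (reg 3),
    .store (addrExpr 9 (reg 1)) (const 0),
    .store (addrExpr 11 (reg 3)) (reg 2),
    .assign 2 (reg 2 + fieldExpr 5 (reg 1)),
    .store (addrExpr 12 (reg 3)) (reg 2),
    .assign 3 (reg 3 + const 1)]

/-- The entry of the variable at its position, and the data of the next variable on the path. -/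
def linkBlock : Prog :=
  block [
    .store (addrExpr 10 (fieldExpr 7 (reg 1))) (reg 1),
    .ite (fieldExpr 3 (reg 1))
      (block [
        .assign 4 (fieldExpr 3 (reg 1) - const 1),
        .store (addrExpr 7 (reg 4)) (fieldExpr 7 (reg 1) + const 1),
        .store (addrExpr 8 (reg 4)) (fieldExpr 8 (reg 1)),
        .assign 5 (load (const 3 * reg 1 + const 1)),
        .ite (.op .eq (reg 4) (reg 5))
          (.store (addrExpr 9 (reg 4)) (fieldExpr 9 (reg 1)))
          (.store (addrExpr 9 (reg 4)) (fieldExpr 9 (reg 1) + fieldExpr 1 (reg 5)))])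
      .skip]

/-- Variables are visited in descending order because position, root task and offset are handed from
a variable to its successor, which has a smaller index. -/
def layoutBody : Prog :=
  block [
    .assign 1 (reg 1 - const 1),
    .ite (fieldExpr 0 (reg 1)) (.seq (.ite (fieldExpr 6 (reg 1)) .skip topBlock) linkBlock) .skip]

/-- The program that arranges the variables of each path at consecutive positions. -/
def layoutProg : Prog :=
  block [
    .assign 1 (reg 0),
    .assign 2 (const 0),
    .assign 3 (const 0),
    .while (reg 1) layoutBody]

/-- The fields of the first passes are unchanged. -/
theorem Filled.congr {mem mem' : ℕ → ℕ} {k : ℕ} (h : G.Filled k mem) (hinput : G.HasInput mem')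
    (hf : ∀ f z, f < 7 → G.field mem' f z = G.field mem f z) : G.Filled k mem' := by
  obtain ⟨-, h0, h1, h2, h3, h4, h5, h6, h7⟩ := h
  refine ⟨hinput, ?_, ?_, ?_, ?_, ?_, ?_, ?_, ?_⟩ <;>
    simpa only [hf _ _ (show 0 < 7 by decide), hf _ _ (show 1 < 7 by decide),
      hf _ _ (show 2 < 7 by decide), hf _ _ (show 3 < 7 by decide), hf _ _ (show 4 < 7 by decide),
      hf _ _ (show 5 < 7 by decide), hf _ _ (show 6 < 7 by decide)]

/-- The variables in `O` have got positions, and those from `k` on have been entered at their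
positions and have handed on their data. There are `n` tasks, and positions below `a` are taken. -/
structure Layout (G : SLP) (O : ℕ → Prop) (k a n : ℕ) (mem : ℕ → ℕ) : Prop where
  tasks_le : n ≤ a
  sum : ∑ t ∈ Finset.range n, (G.field mem 12 t - G.field mem 11 t) = a
  root_lt : ∀ j, O j → G.field mem 8 j < n
  lo_le : ∀ j, O j → G.field mem 11 (G.field mem 8 j) ≤ G.field mem 7 j
  hi_eq : ∀ j, O j → G.field mem 12 (G.field mem 8 j) = G.field mem 7 j + G.pathLen j
  pos_le : ∀ j, O j → G.field mem 7 j + G.pathLen j ≤ a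
  off_le : ∀ j, O j → G.field mem 9 j + G.len j ≤ G.word.length
  pos_next : ∀ p u, k ≤ p → G.Reach p → G.next p = u + 1 →
    G.field mem 7 u = G.field mem 7 p + 1
  root_next : ∀ p u, k ≤ p → G.Reach p → G.next p = u + 1 → G.field mem 8 u = G.field mem 8 p
  off_next : ∀ p u, k ≤ p → G.Reach p → G.next p = u + 1 →
    G.field mem 9 u = G.field mem 9 p + if u = G.fst p then 0 else G.len (G.fst p)
  entry : ∀ j, k ≤ j → G.Reach j → G.field mem 10 (G.field mem 7 j) = j
  -- A variable `i` that is still to be entered reserves the block of `pathLen i` positions from its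
  -- own on; no other position that has been given out lies in this block.
  disjoint : ∀ j i, O j → O i → i < k → i ≠ j → G.field mem 7 j < G.field mem 7 i ∨
    G.field mem 7 i + G.pathLen i ≤ G.field mem 7 j
  first : ∀ t < n, ∃ j, O j ∧ G.field mem 7 j = G.field mem 11 t ∧ G.field mem 8 j = t

/-- The new path takes the fresh block of positions from `a` on and the fresh task `n`, so nothing
recorded before is touched; `hnext` excludes that `k` has already received data from a predecessor.
-/
theorem Layout.top {O : ℕ → Prop} {k K a n : ℕ} {mem mem' : ℕ → ℕ} (h : G.Layout O K a n mem)
    (hk : G.Reach k) (hkK : k < K) (hO : ¬O k)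
    (hnext : ∀ p, K ≤ p → G.Reach p → G.next p ≠ k + 1)
    (h7 : ∀ z, G.field mem' 7 z = if z = k then a else G.field mem 7 z)
    (h8 : ∀ z, G.field mem' 8 z = if z = k then n else G.field mem 8 z)
    (h9 : ∀ z, G.field mem' 9 z = if z = k then 0 else G.field mem 9 z)
    (h10 : ∀ z, G.field mem' 10 z = G.field mem 10 z)
    (h11 : ∀ t, G.field mem' 11 t = if t = n then a else G.field mem 11 t)
    (h12 : ∀ t, G.field mem' 12 t = if t = n then a + G.pathLen k else G.field mem 12 t) :
    G.Layout (fun j => O j ∨ j = k) K (a + G.pathLen k) (n + 1) mem' := by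
  have hp := G.pathLen_pos k
  have hOk : ∀ j, O j → j ≠ k := fun j hj he => hO (he ▸ hj)
  have hnk : ∀ p u, K ≤ p → G.Reach p → G.next p = u + 1 → p ≠ k ∧ u ≠ k := fun p u hp hr h =>
    ⟨by omega, fun he => hnext p hp hr (he ▸ h)⟩
  have hroot : ∀ j, O j → G.field mem 8 j ≠ n := fun j hj => (h.root_lt j hj).ne
  refine ⟨?_, ?_, ?_, ?_, ?_, ?_, ?_, ?_, ?_, ?_, ?_, ?_, ?_⟩
  · have := h.tasks_le
    omega
  · rw [Finset.sum_range_succ, h11, h12, if_pos rfl, if_pos rfl, Nat.add_sub_cancel_left]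
    congr 1
    rw [← h.sum]
    refine Finset.sum_congr rfl fun t ht => ?_
    have := Finset.mem_range.1 ht
    rw [h11, h12, if_neg this.ne, if_neg this.ne]
  · rintro j (hj | rfl)
    · rw [h8, if_neg (hOk j hj)]
      have := h.root_lt j hj
      omega
    · simp [h8]
  · rintro j (hj | rfl)
    · rw [h8, h7, h11, if_neg (hOk j hj), if_neg (hOk j hj), if_neg (hroot j hj)]
      exact h.lo_le j hj
    · simp [h8, h7, h11]
  · rintro j (hj | rfl)
    · rw [h8, h7, h12, if_neg (hOk j hj), if_neg (hOk j hj), if_neg (hroot j hj)]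
      exact h.hi_eq j hj
    · simp [h8, h7, h12]
  · rintro j (hj | rfl)
    · rw [h7, if_neg (hOk j hj)]
      have := h.pos_le j hj
      omega
    · simp [h7]
  · rintro j (hj | rfl)
    · rw [h9, if_neg (hOk j hj)]
      exact h.off_le j hj
    · simpa [h9] using hk.len_le
  · intro p u hp hr hn
    rw [h7, h7, if_neg (hnk p u hp hr hn).1, if_neg (hnk p u hp hr hn).2]
    exact h.pos_next p u hp hr hn
  · intro p u hp hr hn
    rw [h8, h8, if_neg (hnk p u hp hr hn).1, if_neg (hnk p u hp hr hn).2]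
    exact h.root_next p u hp hr hn
  · intro p u hp hr hn
    rw [h9, h9, if_neg (hnk p u hp hr hn).1, if_neg (hnk p u hp hr hn).2]
    exact h.off_next p u hp hr hn
  · intro j hj hr
    rw [h7, if_neg (by omega), h10]
    exact h.entry j hj hr
  · rintro j i (hj | rfl) (hi | rfl) hiK hne
    · rw [h7, h7, if_neg (hOk j hj), if_neg (hOk i hi)]
      exact h.disjoint j i hj hi hiK hne
    · rw [h7, h7, if_neg (hOk j hj), if_pos rfl]
      have h1 := h.pos_le j hj
      have h2 := G.pathLen_pos j
      omega
    · rw [h7, h7, if_neg (hOk i hi), if_pos rfl]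
      exact .inr (h.pos_le i hi)
    · exact absurd rfl hne
  · intro t ht
    rcases Nat.lt_succ_iff_lt_or_eq.1 ht with ht | rfl
    · obtain ⟨j, hj, h1, h2⟩ := h.first t ht
      refine ⟨j, .inl hj, ?_, ?_⟩
      · rw [h7, h11, if_neg (hOk j hj), if_neg ht.ne, h1]
      · rw [h8, if_neg (hOk j hj), h2]
    · exact ⟨k, .inr rfl, by simp [h7, h11], by simp [h8]⟩

/-- The block reserved by `k` contains its own position, so entering `k` there overwrites no other
entry. -/
theorem Layout.pos_ne {O : ℕ → Prop} {k a n : ℕ} {mem : ℕ → ℕ} (h : G.Layout O (k + 1) a n mem)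
    (hOk : O k) {j : ℕ} (hO : O j) (hj : j ≠ k) : G.field mem 7 j ≠ G.field mem 7 k := by
  have h1 := h.disjoint j k hO hOk (by omega) hj.symm
  have h2 := G.pathLen_pos k
  omega

theorem Layout.enter {O : ℕ → Prop} {k a n : ℕ} {mem mem' : ℕ → ℕ}
    (h : G.Layout O (k + 1) a n mem) (hOk : O k) (hO : ∀ j, k ≤ j → G.Reach j → O j)
    (hnext : G.next k = 0)
    (h7 : ∀ f z, f ≠ 10 → f < 13 → G.field mem' f z = G.field mem f z)
    (h10 : ∀ z, G.field mem' 10 z = if z = G.field mem 7 k then k else G.field mem 10 z) :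
    G.Layout O k a n mem' := by
  have e7 := fun z => h7 7 z (by decide) (by decide)
  have e8 := fun z => h7 8 z (by decide) (by decide)
  have e9 := fun z => h7 9 z (by decide) (by decide)
  have e11 := fun z => h7 11 z (by decide) (by decide)
  have e12 := fun z => h7 12 z (by decide) (by decide)
  have hlt : ∀ p u, k ≤ p → G.next p = u + 1 → k + 1 ≤ p := fun p u hp hn => by
    rcases hp.lt_or_eq with hp | rfl
    · exact hp
    · omega
  obtain ⟨g1, g2, g3, g4, g5, g6, g7, g8, g9, g10, g11, g12, g13⟩ := id h
  refine ⟨g1, ?_, ?_, ?_, ?_, ?_, ?_, ?_, ?_, ?_, ?_, ?_, ?_⟩ <;>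
    simp only [e7, e8, e9, e11, e12]
  · exact g2
  · exact g3
  · exact g4
  · exact g5
  · exact g6
  · exact g7
  · exact fun p u hp hr hn => g8 p u (hlt p u hp hn) hr hn
  · exact fun p u hp hr hn => g9 p u (hlt p u hp hn) hr hn
  · exact fun p u hp hr hn => g10 p u (hlt p u hp hn) hr hn
  · intro j hj hr
    rw [h10]
    rcases hj.lt_or_eq with hj | rfl
    · rw [if_neg (h.pos_ne hOk (hO j hj.le hr) hj.ne'), g11 j hj hr]
    · rw [if_pos rfl]
  · exact fun j i hj hi hik => g12 j i hj hi (by omega)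
  · exact g13

/-- The block reserved by `k`, without its first position, becomes the block of the successor `u`.
Since `k` is the only predecessor of `u`, the links recorded for other variables do not involve `u`
as a successor. -/
theorem Layout.link {O : ℕ → Prop} {k u a n : ℕ} {mem mem' : ℕ → ℕ}
    (h : G.Layout O (k + 1) a n mem) (hk : G.Reach k) (hOk : O k)
    (hO : ∀ j, k ≤ j → G.Reach j → O j) (hnext : G.next k = u + 1) (hOu : ¬O u)
    (h7 : ∀ z, G.field mem' 7 z = if z = u then G.field mem 7 k + 1 else G.field mem 7 z)
    (h8 : ∀ z, G.field mem' 8 z = if z = u then G.field mem 8 k else G.field mem 8 z)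
    (h9 : ∀ z, G.field mem' 9 z = if z = u then
      G.field mem 9 k + (if u = G.fst k then 0 else G.len (G.fst k)) else G.field mem 9 z)
    (h10 : ∀ z, G.field mem' 10 z = if z = G.field mem 7 k then k else G.field mem 10 z)
    (h11 : ∀ z, G.field mem' 11 z = G.field mem 11 z)
    (h12 : ∀ z, G.field mem' 12 z = G.field mem 12 z) :
    G.Layout (fun j => O j ∨ j = u) k a n mem' := by
  have hu : u < k := next_lt hk.1 hnext
  have hpl := pathLen_of_next hk.1 hnext
  have hpu := G.pathLen_pos u
  have hne : ∀ j, O j → j ≠ u := fun j hj he => hOu (he ▸ hj)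
  have hnk : ∀ p v, k + 1 ≤ p → G.Reach p → G.next p = v + 1 → p ≠ u ∧ v ≠ u :=
    fun p v hp hr hn => ⟨by omega, fun he => by
      have := next_inj hr.1 hk.1 hn (he ▸ hnext)
      omega⟩
  refine ⟨h.tasks_le, ?_, ?_, ?_, ?_, ?_, ?_, ?_, ?_, ?_, ?_, ?_, ?_⟩
  · simp only [h11, h12]
    exact h.sum
  · rintro j (hj | rfl)
    · rw [h8, if_neg (hne j hj)]
      exact h.root_lt j hj
    · rw [h8, if_pos rfl]
      exact h.root_lt k hOk
  · rintro j (hj | rfl)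
    · rw [h8, h7, h11, if_neg (hne j hj), if_neg (hne j hj)]
      exact h.lo_le j hj
    · rw [h8, h7, h11, if_pos rfl, if_pos rfl]
      exact (h.lo_le k hOk).trans (Nat.le_succ _)
  · rintro j (hj | rfl)
    · rw [h8, h7, h12, if_neg (hne j hj), if_neg (hne j hj)]
      exact h.hi_eq j hj
    · rw [h8, h7, h12, if_pos rfl, if_pos rfl, h.hi_eq k hOk]
      omega
  · rintro j (hj | rfl)
    · rw [h7, if_neg (hne j hj)]
      exact h.pos_le j hj
    · rw [h7, if_pos rfl]
      have := h.pos_le k hOk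
      omega
  · rintro j (hj | rfl)
    · rw [h9, if_neg (hne j hj)]
      exact h.off_le j hj
    · rw [h9, if_pos rfl]
      have h1 := h.off_le k hOk
      have h2 := (isChild_of_next hnext).1
      rw [len_of_tag_one hk.1 h2.1] at h1
      split
      · next he =>
        rw [← he] at h1
        omega
      · next he =>
        rw [← h2.2.resolve_left he] at h1
        omega
  · intro p v hp hr hn
    rcases hp.lt_or_eq with hp | rfl
    · rw [h7, h7, if_neg (hnk p v hp hr hn).1, if_neg (hnk p v hp hr hn).2]
      exact h.pos_next p v hp hr hn
    · obtain rfl : u = v := by omega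
      rw [h7, h7, if_pos rfl, if_neg hu.ne']
  · intro p v hp hr hn
    rcases hp.lt_or_eq with hp | rfl
    · rw [h8, h8, if_neg (hnk p v hp hr hn).1, if_neg (hnk p v hp hr hn).2]
      exact h.root_next p v hp hr hn
    · obtain rfl : u = v := by omega
      rw [h8, h8, if_pos rfl, if_neg hu.ne']
  · intro p v hp hr hn
    rcases hp.lt_or_eq with hp | rfl
    · rw [h9, h9, if_neg (hnk p v hp hr hn).1, if_neg (hnk p v hp hr hn).2]
      exact h.off_next p v hp hr hn
    · obtain rfl : u = v := by omega
      rw [h9, h9, if_pos rfl, if_neg hu.ne']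
  · intro j hj hr
    rw [h7, if_neg (by omega), h10]
    rcases hj.lt_or_eq with hj | rfl
    · rw [if_neg (h.pos_ne hOk (hO j hj.le hr) hj.ne'), h.entry j hj hr]
    · rw [if_pos rfl]
  · rintro j i (hj | rfl) (hi | rfl) hik hij
    · rw [h7, h7, if_neg (hne j hj), if_neg (hne i hi)]
      exact h.disjoint j i hj hi (by omega) hij
    · rw [h7, h7, if_neg (hne j hj), if_pos rfl]
      by_cases hjk : j = k
      · subst hjk
        omega
      · have := h.disjoint j k hj hOk (by omega) (Ne.symm hjk)
        omega
    · rw [h7, h7, if_neg (hne i hi), if_pos rfl]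
      have h1 := h.disjoint k i hOk hi (by omega) (by omega)
      have h2 := h.disjoint i k hi hOk (by omega) (by omega)
      omega
    · exact absurd rfl hij
  · intro t ht
    obtain ⟨j, hj, h1, h2⟩ := h.first t ht
    exact ⟨j, .inl hj, by rw [h7, if_neg (hne j hj), h11, h1], by rw [h8, if_neg (hne j hj), h2]⟩

theorem Layout.skip {O : ℕ → Prop} {k a n : ℕ} {mem : ℕ → ℕ}
    (h : G.Layout O (k + 1) a n mem) (hk : ¬G.Reach k) : G.Layout O k a n mem := by
  have hlt : ∀ p, k ≤ p → G.Reach p → k + 1 ≤ p := fun p hp hr => by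
    rcases hp.lt_or_eq with hp | rfl
    exacts [hp, absurd hr hk]
  exact ⟨h.1, h.2, h.3, h.4, h.5, h.6, h.7, fun p u hp hr => h.8 p u (hlt p hp hr) hr,
    fun p u hp hr => h.9 p u (hlt p hp hr) hr, fun p u hp hr => h.10 p u (hlt p hp hr) hr,
    fun p hp hr => h.11 p (hlt p hp hr) hr, fun j i hj hi hik => h.12 j i hj hi (by omega), h.13⟩

theorem Layout.congr_left {O O' : ℕ → Prop} {k a n : ℕ} {mem : ℕ → ℕ}
    (h : G.Layout O k a n mem) (hO : ∀ j, O j ↔ O' j) : G.Layout O' k a n mem := by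
  rwa [← funext fun j => propext (hO j)]

theorem topBlock_spec (hw : G.Roomy w) {k a n : ℕ} (hk : G.Reach k) {σ : State} {O : ℕ → Prop}
    (h0 : σ.reg 0 = G.numVars) (h1 : σ.reg 1 = k) (h2 : σ.reg 2 = a) (h3 : σ.reg 3 = n)
    (hf : G.Filled G.numVars σ.mem) (hl : G.Layout O (k + 1) a n σ.mem) (hO : ¬O k)
    (hnext : ∀ p, k + 1 ≤ p → G.Reach p → G.next p ≠ k + 1) (ha : a + G.pathLen k ≤ G.numVars)
    (t : ℕ) :
    WP w (51 * G.numVars) topBlock σ t fun t' τ => t' ≤ t + 100 ∧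
      τ.reg 0 = G.numVars ∧ τ.reg 1 = k ∧ τ.reg 2 = a + G.pathLen k ∧ τ.reg 3 = n + 1 ∧
      G.Filled G.numVars τ.mem ∧
      G.Layout (fun j => O j ∨ j = k) (k + 1) (a + G.pathLen k) (n + 1) τ.mem := by
  have hw' := hw
  unfold Roomy at hw'
  have hk1 := hk.1
  have hn := hl.tasks_le
  have i3 : k < 3 * G.numVars := by omega
  have i4 : n < 3 * G.numVars := by have := G.pathLen_pos k; omega
  have n1 : σ.mem (fieldAddr G.numVars 5 k) = _ := hf.pathLen _ hk1 hk
  simp [topBlock, block, fieldAddr_inj, h0, h1, h2, h3, WordRAM.fieldAddr_lt, hw.fieldAddr_lt,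
    i3, i4, n1]
  refine ⟨by omega, by omega, hf.congr ?_ ?_, hl.top hk (by omega) hO hnext ?_ ?_ ?_ ?_ ?_ ?_⟩
  · exact ((((hf.input.update _ _ _).update _ _ _).update _ _ _).update _ _ _).update _ _ _
  · intro f z hf
    simp [field_update, show f < 16 by omega, show f ≠ 7 by omega, show f ≠ 8 by omega,
      show f ≠ 9 by omega, show f ≠ 11 by omega, show f ≠ 12 by omega]
  all_goals intro z; simp [field_update]

theorem linkBlock_spec (hw : G.Roomy w) {k a n : ℕ} (hk : G.Reach k) {σ : State} {O : ℕ → Prop}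
    (h0 : σ.reg 0 = G.numVars) (h1 : σ.reg 1 = k)
    (hf : G.Filled G.numVars σ.mem) (hl : G.Layout O (k + 1) a n σ.mem) (hOk : O k)
    (hO : ∀ j, k ≤ j → G.Reach j → O j) (hOu : ∀ u, G.next k = u + 1 → ¬O u)
    (ha : a ≤ G.numVars) (t : ℕ) :
    WP w (51 * G.numVars) linkBlock σ t fun t' τ => t' ≤ t + 250 ∧
      τ.reg 0 = G.numVars ∧ τ.reg 1 = k ∧ τ.reg 2 = σ.reg 2 ∧ τ.reg 3 = σ.reg 3 ∧
      G.Filled G.numVars τ.mem ∧ G.Layout (fun j => O j ∨ G.next k = j + 1) k a n τ.mem := by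
  have hw' := hw
  unfold Roomy at hw'
  have hk1 := hk.1
  have i3 : k < 3 * G.numVars := by omega
  have n1 : σ.mem (fieldAddr G.numVars 3 k) = _ := hf.next _ hk1 hk
  obtain ⟨x, hx⟩ : ∃ x, σ.mem (fieldAddr G.numVars 7 k) = x := ⟨_, rfl⟩
  have hx' : G.field σ.mem 7 k = x := hx
  have hxa := hl.pos_le k hOk
  rw [hx'] at hxa
  have i4 : x < 3 * G.numVars := by have := G.pathLen_pos k; omega
  rcases hn : G.next k with _ | u
  · simp [linkBlock, block, fieldAddr_inj, h0, h1, WordRAM.fieldAddr_lt, hw.fieldAddr_lt, i3, n1,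
      hn, hx, i4]
    refine ⟨hf.congr (hf.input.update _ _ _) ?_, hl.enter hOk hO hn ?_ ?_⟩
    · intro f z hf
      simp [field_update, show f < 16 by omega, show f ≠ 10 by omega]
    · intro f z hne hf
      simp [field_update, show f < 16 by omega, hne]
    · intro z
      simp [field_update, hx']
  · have hu := next_lt hk1 hn
    have hc := isChild_of_next hn
    have i5 : u < 3 * G.numVars := by omega
    have e1 := hf.input.fst hk1
    have l1 := fst_lt hk1 hc.1.1
    have i6 : G.fst k < 3 * G.numVars := by omega
    have r1 : G.Reach (G.fst k) := hk.child ⟨hc.1.1, .inl rfl⟩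
    have n2 : σ.mem (fieldAddr G.numVars 1 (G.fst k)) = _ := hf.len _ r1.1 r1
    have i7 : 3 * k + 1 < 3 * G.numVars := by omega
    have b1 := hl.off_le k hOk
    have b2 := len_child_le (z := G.fst k) hk1 ⟨hc.1.1, .inl rfl⟩
    obtain ⟨y, hy⟩ : ∃ y, σ.mem (fieldAddr G.numVars 9 k) = y := ⟨_, rfl⟩
    have hy' : G.field σ.mem 9 k = y := hy
    obtain ⟨v, hv⟩ : ∃ v, σ.mem (fieldAddr G.numVars 8 k) = v := ⟨_, rfl⟩
    have hv' : G.field σ.mem 8 k = v := hv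
    rw [hy'] at b1
    simp [linkBlock, block, Function.update_apply, fieldAddr_inj, ne_fieldAddr, h0, h1,
      WordRAM.fieldAddr_lt, hw.fieldAddr_lt, i3, i4, i5, i6, i7, n1, n2, hn, hx, hy, hv, e1]
    refine ⟨by omega, by omega, fun he => ⟨?_, ?_⟩, fun he => ⟨by omega, ?_, ?_⟩⟩
    · refine hf.congr ((((hf.input.update _ _ _).update _ _ _).update _ _ _).update _ _ _) ?_
      intro f z hf
      simp [field_update, show f < 16 by omega, show f ≠ 7 by omega, show f ≠ 8 by omega,
        show f ≠ 9 by omega, show f ≠ 10 by omega]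
    · refine (hl.link hk hOk hO hn (hOu u hn) ?_ ?_ ?_ ?_ ?_ ?_).congr_left
        (fun j => by rw [eq_comm (a := u)])
      all_goals intro z; simp [field_update, hx', hy', hv', he]
    · refine hf.congr ((((hf.input.update _ _ _).update _ _ _).update _ _ _).update _ _ _) ?_
      intro f z hf
      simp [field_update, show f < 16 by omega, show f ≠ 7 by omega, show f ≠ 8 by omega,
        show f ≠ 9 by omega, show f ≠ 10 by omega]
    · refine (hl.link hk hOk hO hn (hOu u hn) ?_ ?_ ?_ ?_ ?_ ?_).congr_left
        (fun j => by rw [eq_comm (a := u)])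
      all_goals intro z; simp [field_update, hx', hy', hv', he]

/-- The variables that have got a position after the steps for the variables from `k` on. -/
def Owned (G : SLP) (k j : ℕ) : Prop := G.Reach j ∧ (k ≤ j ∨ G.Inner k j)

open Classical in
/-- The number of positions on the paths that start with the variables from `k` on. -/
noncomputable def topSum (G : SLP) (k : ℕ) : ℕ :=
  ∑ j ∈ (Finset.range G.numVars).filter (fun j => k ≤ j ∧ G.Reach j ∧ ¬G.Inner 0 j), G.pathLen j

theorem topSum_le (k : ℕ) : G.topSum k ≤ G.numVars := by
  classical
  refine le_trans (Finset.sum_le_sum_of_subset fun j hj => ?_) (sum_pathLen_le (G := G))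
  simp only [Finset.mem_filter] at hj ⊢
  exact ⟨hj.1, hj.2.2⟩

theorem topSum_numVars : G.topSum G.numVars = 0 := by
  classical
  rw [topSum, Finset.sum_eq_zero]
  intro j hj
  simp only [Finset.mem_filter, Finset.mem_range] at hj
  omega

theorem topSum_of_top {k : ℕ} (hk : G.Reach k) (h : ¬G.Inner 0 k) :
    G.topSum k = G.topSum (k + 1) + G.pathLen k := by
  classical
  rw [topSum, topSum, add_comm, ← Finset.sum_insert (by simp)]
  congr 1
  ext j
  simp only [Finset.mem_filter, Finset.mem_range, Finset.mem_insert]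
  constructor
  · rintro ⟨h1, h2, h3⟩
    rcases h2.lt_or_eq with h2 | rfl
    exacts [.inr ⟨h1, h2, h3⟩, .inl rfl]
  · rintro (rfl | ⟨h1, h2, h3⟩)
    exacts [⟨hk.1, le_rfl, hk, h⟩, ⟨h1, by omega, h3⟩]

theorem topSum_of_not_top {k : ℕ} (h : ¬(G.Reach k ∧ ¬G.Inner 0 k)) :
    G.topSum k = G.topSum (k + 1) := by
  classical
  rw [topSum, topSum]
  congr 1
  refine Finset.filter_congr fun j _ => ⟨fun ⟨h2, h3⟩ => ?_, fun ⟨h2, h3⟩ => ⟨by omega, h3⟩⟩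
  rcases h2.lt_or_eq with h2 | rfl
  exacts [⟨h2, h3⟩, absurd h3 h]

theorem owned_iff {k : ℕ} (hk : G.Reach k) (j : ℕ) :
    ((G.Owned (k + 1) j ∨ j = k) ∨ G.next k = j + 1) ↔ G.Owned k j := by
  constructor
  · rintro ((⟨hr, h | ⟨p, hp, h⟩⟩ | rfl) | h)
    · exact ⟨hr, .inl (by omega)⟩
    · exact ⟨hr, .inr ⟨p, by omega, h⟩⟩
    · exact ⟨hk, .inl le_rfl⟩
    · exact ⟨hk.next h, .inr ⟨k, le_rfl, hk, h⟩⟩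
  · rintro ⟨hr, h | ⟨p, hp, h⟩⟩
    · rcases h.lt_or_eq with h | rfl
      exacts [.inl (.inl ⟨hr, .inl h⟩), .inl (.inr rfl)]
    · rcases hp.lt_or_eq with hp | rfl
      exacts [.inl (.inl ⟨hr, .inr ⟨p, hp, h⟩⟩), .inr h.2]

theorem owned_succ_iff {k : ℕ} (hk : ¬G.Reach k) (j : ℕ) :
    G.Owned (k + 1) j ↔ G.Owned k j := by
  have hlt : ∀ p, k ≤ p → G.Reach p → k + 1 ≤ p := fun p hp hr => by
    rcases hp.lt_or_eq with hp | rfl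
    exacts [hp, absurd hr hk]
  constructor
  · rintro ⟨hr, h | ⟨p, hp, h⟩⟩
    exacts [⟨hr, .inl (by omega)⟩, ⟨hr, .inr ⟨p, by omega, h⟩⟩]
  · rintro ⟨hr, h | ⟨p, hp, h⟩⟩
    exacts [⟨hr, .inl (hlt j h hr)⟩, ⟨hr, .inr ⟨p, hlt p hp h.1, h⟩⟩]

/-- The state before the step of `layoutProg` for the variable `k - 1`. -/
structure LayoutInv (G : SLP) (k : ℕ) (σ : State) : Prop where
  le : k ≤ G.numVars
  reg0 : σ.reg 0 = G.numVars
  reg1 : σ.reg 1 = k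
  reg2 : σ.reg 2 = G.topSum k
  filled : G.Filled G.numVars σ.mem
  layout : G.Layout (G.Owned k) k (G.topSum k) (σ.reg 3) σ.mem

theorem layoutBody_spec (hw : G.Roomy w) {k : ℕ} {σ : State} (h : G.LayoutInv (k + 1) σ) :
    WP w (51 * G.numVars) layoutBody σ 0 fun t τ => t ≤ 450 ∧ G.LayoutInv k τ := by
  obtain ⟨hk, h0, h1, h2, hf, hl⟩ := h
  have hk : k < G.numVars := hk
  have i3 : k < 3 * G.numVars := by omega
  have c0 : σ.mem (fieldAddr G.numVars 0 k) = _ := hf.count _ hk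
  have hinner : G.Inner 0 k ↔ ∃ p < G.numVars, G.Reach p ∧ G.next p = k + 1 :=
    ⟨fun ⟨p, _, hp, h⟩ => ⟨p, hp.1, hp, h⟩, fun ⟨p, _, hp⟩ => ⟨p, Nat.zero_le _, hp⟩⟩
  by_cases hr : G.Reach k
  · have hne := hr.2.ne'
    -- The successor has no position yet: it is smaller than `k`, and `k` is its only predecessor.
    have hnk : ∀ u, G.next k = u + 1 → u < k ∧ ¬G.Owned (k + 1) u := fun u hu => by
      have hlt := next_lt hk hu
      refine ⟨hlt, ?_⟩
      rintro ⟨-, h | ⟨p, hp, hp', h⟩⟩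
      · omega
      · have := next_inj hp'.1 hk h hu
        omega
    have hfin : ∀ (τ : State) (a n : ℕ), G.topSum k = a → τ.reg 0 = G.numVars → τ.reg 1 = k →
        τ.reg 2 = a → τ.reg 3 = n → G.Filled G.numVars τ.mem →
        G.Layout (fun j => G.Owned (k + 1) j ∨ j = k) (k + 1) a n τ.mem → ∀ t, t ≤ 150 →
        WP w (51 * G.numVars) linkBlock τ t fun t' υ => t' < 450 ∧ G.LayoutInv k υ := by
      rintro τ a n rfl g0 g1 g2 rfl gf gl t ht
      refine (linkBlock_spec hw hr g0 g1 gf gl (.inr rfl) ?_ ?_ (topSum_le k) t).mono ?_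
      · intro j hj hrj
        rcases hj.lt_or_eq with hj | rfl
        exacts [.inl ⟨hrj, .inl hj⟩, .inr rfl]
      · rintro u hu (h | rfl)
        · exact (hnk u hu).2 h
        · exact (hnk u hu).1.false
      · rintro t' υ ⟨q, q0, q1, q2, q3, qf, ql⟩
        exact ⟨by omega, hk.le, q0, q1, q2.trans g2, qf, q3 ▸ ql.congr_left (owned_iff hr)⟩
    by_cases hi : G.Inner 0 k
    · have c6 : σ.mem (fieldAddr G.numVars 6 k) = 1 := hf.inner k hk hr (hinner.1 hi)
      have hOk : G.Owned (k + 1) k := by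
        obtain ⟨p, -, hp, hpk⟩ := hi
        exact ⟨hr, .inr ⟨p, next_lt hp.1 hpk, hp, hpk⟩⟩
      have hts : G.topSum k = G.topSum (k + 1) := topSum_of_not_top fun h => h.2 hi
      simp [layoutBody, block, h0, h1, c0, hne, c6, WordRAM.fieldAddr_lt,
        hw.fieldAddr_lt, i3]
      refine hfin ⟨Function.update σ.reg 1 k, σ.mem⟩ _ _ hts ?_ ?_ ?_ rfl hf ?_ _ (by norm_num)
      · simp [h0]
      · simp
      · simp [h2]
      · refine hl.congr_left fun j => ⟨.inl, ?_⟩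
        rintro (h | rfl)
        exacts [h, hOk]
    · have c6 : σ.mem (fieldAddr G.numVars 6 k) = 0 :=
        hf.notInner k hk hr (fun h => hi (hinner.2 h))
      have hnext : ∀ p, k + 1 ≤ p → G.Reach p → G.next p ≠ k + 1 := fun p _ hp h =>
        hi ⟨p, Nat.zero_le _, hp, h⟩
      have hOk : ¬G.Owned (k + 1) k := by
        rintro ⟨-, h | ⟨p, hp, hp', h⟩⟩
        · omega
        · exact hnext p hp hp' h
      have hts := topSum_of_top hr hi
      simp [layoutBody, block, h0, h1, c0, hne, c6, WordRAM.fieldAddr_lt,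
        hw.fieldAddr_lt, i3]
      refine (topBlock_spec hw (σ := ⟨Function.update σ.reg 1 k, σ.mem⟩)
        (n := σ.reg 3) (a := G.topSum (k + 1)) hr ?_ ?_ ?_ ?_ hf hl hOk
        hnext (hts ▸ topSum_le k) _).mono ?_
      · simp [h0]
      · simp
      · simp [h2]
      · simp
      · rintro t τ ⟨q, q0, q1, q2, q3, qf, ql⟩
        exact hfin τ _ _ hts q0 q1 q2 q3 qf ql t (by omega)
  · have hne : G.occ k = 0 := by
      by_contra hne
      exact hr ⟨hk, Nat.pos_of_ne_zero hne⟩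
    have hts : G.topSum k = G.topSum (k + 1) := topSum_of_not_top fun h => hr h.1
    simp [layoutBody, block, h0, h1, c0, hne, WordRAM.fieldAddr_lt,
      hw.fieldAddr_lt, i3]
    refine ⟨hk.le, by simp [h0], by simp, by simp [h2, hts], hf, ?_⟩
    rw [hts]
    exact (hl.skip hr).congr_left (owned_succ_iff hr)

theorem layoutProg_spec (hw : G.Roomy w) {σ : State} (h0 : σ.reg 0 = G.numVars)
    (hf : G.Filled G.numVars σ.mem) (t : ℕ) :
    WP w (51 * G.numVars) layoutProg σ t fun t' τ =>
      t' ≤ t + 460 * G.numVars + 20 ∧ G.LayoutInv 0 τ := by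
  have hw' := hw
  unfold Roomy at hw'
  simp [layoutProg, block, h0]
  refine WP.while (w := w) (by omega) 450 G.LayoutInv (fun _ _ _ => safe_reg ..) ?_ G.numVars ?_ ?_
  · intro n τ hI hc
    obtain _ | k := n
    · exact absurd hI.reg1 hc
    · exact ⟨k, rfl, layoutBody_spec hw hI⟩
  · have hno : ∀ p, G.numVars ≤ p → G.Reach p → False := fun p hp hr => by
      have := hr.1
      omega
    have hno' : ∀ j, G.Owned G.numVars j → False := by
      rintro j ⟨hr, h | ⟨p, hp, hr', -⟩⟩
      exacts [hno j h hr, hno p hp hr']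
    refine ⟨le_rfl, by simp [h0], by simp, by simp [topSum_numVars], hf, ?_⟩
    simp only [Function.update_self]
    refine ⟨Nat.zero_le _, by simp [topSum_numVars], fun j hj => (hno' j hj).elim,
      fun j hj => (hno' j hj).elim, fun j hj => (hno' j hj).elim, fun j hj => (hno' j hj).elim,
      fun j hj => (hno' j hj).elim, fun p _ hp hr => (hno p hp hr).elim,
      fun p _ hp hr => (hno p hp hr).elim, fun p _ hp hr => (hno p hp hr).elim,
      fun p hp hr => (hno p hp hr).elim, fun j _ hj => (hno' j hj).elim,
      fun t ht => absurd ht (Nat.not_lt_zero t)⟩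
  · intro t' n τ ht hI hc
    have : n = 0 := by
      rw [← hI.reg1]
      exact hc
    subst this
    simp at ht
    exact ⟨by omega, hI⟩

/-! ### The search trees of the paths -/

/-- The binary search, between the registers `7` and `8`, for the position at which a task is
divided. -/
def bisectBody : Prog :=
  block [
    .assign 9 ((reg 7 + reg 8) / const 2),
    .ite (.op .lt (reg 6) (fieldExpr 4 (fieldExpr 10 (reg 9)) + fieldExpr 4 (fieldExpr 10 (reg 9))))
      (.assign 7 (reg 9 + const 1))
      (.assign 8 (reg 9))]

/-- Lengths decrease along a path, so the positions whose next length is at most half the value in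
register `6` form a final segment of the interval. The last position of the interval is always among
them; the loop finds the first. -/
def bisectProg : Prog :=
  block [
    .assign 6 (fieldExpr 1 (fieldExpr 10 (reg 4)) + fieldExpr 4 (fieldExpr 10 (reg 5 - const 1))),
    .assign 7 (reg 4),
    .assign 8 (reg 5 - const 1),
    .while (.op .lt (reg 7) (reg 8)) bisectBody]

/-- The division of the task in register `1` at the position in register `7`. -/
def splitBlock : Prog :=
  block [
    .store (addrExpr 13 (reg 1)) (reg 7),
    .store (addrExpr 14 (reg 1)) (reg 3),
    .store (addrExpr 11 (reg 3)) (reg 4),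
    .store (addrExpr 12 (reg 3)) (reg 7),
    .store (addrExpr 11 (reg 3 + const 1)) (reg 7 + const 1),
    .store (addrExpr 12 (reg 3 + const 1)) (reg 5),
    .assign 3 (reg 3 + const 2)]

/-- The tasks form a queue: those from register `1` up to register `3` are waiting. An empty
interval is a leaf and is not divided. -/
def searchBody : Prog :=
  block [
    .assign 4 (fieldExpr 11 (reg 1)),
    .assign 5 (fieldExpr 12 (reg 1)),
    .ite (.op .lt (reg 4) (reg 5)) (.seq bisectProg splitBlock) .skip,
    .assign 1 (reg 1 + const 1)]

/-- The program that builds the search trees of the paths. -/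
def searchProg : Prog :=
  block [
    .assign 1 (const 0),
    .while (.op .lt (reg 1) (reg 3)) searchBody,
    -- Cell 2 is the spare third word of the first rule, which must be a terminal rule. It keeps the
    -- number of variables for the queries, which receive only a position.
    .store (const 2) (reg 0)]

/-- The positions from `lo` to `hi - 1` hold consecutive variables of a path. -/
def Chain (G : SLP) (mem : ℕ → ℕ) (lo hi : ℕ) : Prop :=
  ∀ e, lo ≤ e → e < hi → G.Reach (G.field mem 10 e) ∧ G.field mem 7 (G.field mem 10 e) = e ∧
    (e + 1 < hi → G.next (G.field mem 10 e) = G.field mem 10 (e + 1) + 1)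

theorem Chain.mono {mem : ℕ → ℕ} {lo hi lo' hi' : ℕ} (h : G.Chain mem lo hi) (hlo : lo ≤ lo')
    (hhi : hi' ≤ hi) : G.Chain mem lo' hi' := fun e h1 h2 =>
  ⟨(h e (by omega) (by omega)).1, (h e (by omega) (by omega)).2.1, fun h3 =>
    (h e (by omega) (by omega)).2.2 (by omega)⟩

/-- Twice the middle between the length at `lo` and the length behind `hi - 1`. -/
def middle (G : SLP) (mem : ℕ → ℕ) (lo hi : ℕ) : ℕ :=
  G.len (G.field mem 10 lo) + G.nextLen (G.field mem 10 (hi - 1))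

/-- The task `t` has been divided into two tasks, such that the lengths are halved. -/
structure Divided (G : SLP) (n : ℕ) (mem : ℕ → ℕ) (t : ℕ) : Prop where
  lo_le : G.field mem 11 t ≤ G.field mem 13 t
  lt_hi : G.field mem 13 t < G.field mem 12 t
  child_lt : G.field mem 14 t + 1 < n
  lo_left : G.field mem 11 (G.field mem 14 t) = G.field mem 11 t
  hi_left : G.field mem 12 (G.field mem 14 t) = G.field mem 13 t
  lo_right : G.field mem 11 (G.field mem 14 t + 1) = G.field mem 13 t + 1
  hi_right : G.field mem 12 (G.field mem 14 t + 1) = G.field mem 12 t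
  nextLen_le : 2 * G.nextLen (G.field mem 10 (G.field mem 13 t)) ≤
    G.middle mem (G.field mem 11 t) (G.field mem 12 t)
  lt_len : G.field mem 11 t < G.field mem 13 t →
    G.middle mem (G.field mem 11 t) (G.field mem 12 t) <
      2 * G.len (G.field mem 10 (G.field mem 13 t))

/-- The positions and the offsets of the variables, and `n` tasks, the first `T` of which have
been processed. -/
structure Search (G : SLP) (T n : ℕ) (mem : ℕ → ℕ) : Prop where
  filled : G.Filled G.numVars mem
  root_lt : ∀ j, G.Reach j → G.field mem 8 j < n
  lo_le : ∀ j, G.Reach j → G.field mem 11 (G.field mem 8 j) ≤ G.field mem 7 j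
  hi_eq : ∀ j, G.Reach j → G.field mem 12 (G.field mem 8 j) = G.field mem 7 j + G.pathLen j
  off_le : ∀ j, G.Reach j → G.field mem 9 j + G.len j ≤ G.word.length
  pos_next : ∀ p u, G.Reach p → G.next p = u + 1 → G.field mem 7 u = G.field mem 7 p + 1
  root_next : ∀ p u, G.Reach p → G.next p = u + 1 → G.field mem 8 u = G.field mem 8 p
  off_next : ∀ p u, G.Reach p → G.next p = u + 1 →
    G.field mem 9 u = G.field mem 9 p + if u = G.fst p then 0 else G.len (G.fst p)
  entry : ∀ j, G.Reach j → G.field mem 10 (G.field mem 7 j) = j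
  le : T ≤ n
  chain : ∀ t < n, G.Chain mem (G.field mem 11 t) (G.field mem 12 t)
  hi_le : ∀ t < n, G.field mem 12 t ≤ G.numVars
  -- A division creates two tasks while the waiting intervals lose one position in total, so this
  -- quantity does not grow and bounds the number of tasks.
  potential : n + 2 * ∑ t ∈ Finset.Ico T n, (G.field mem 12 t - G.field mem 11 t) ≤ 3 * G.numVars
  divided : ∀ t < T, G.field mem 11 t < G.field mem 12 t → G.Divided n mem t

theorem owned_zero_iff (j : ℕ) : G.Owned 0 j ↔ G.Reach j :=
  ⟨fun h => h.1, fun h => ⟨h, .inl (Nat.zero_le _)⟩⟩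

theorem Layout.search {n : ℕ} {mem : ℕ → ℕ} (hf : G.Filled G.numVars mem)
    (hl : G.Layout (G.Owned 0) 0 (G.topSum 0) n mem) : G.Search 0 n mem := by
  have hl := hl.congr_left owned_zero_iff
  have hm := topSum_le (G := G) 0
  have hpos : ∀ j, G.Reach j → 0 < G.pathLen j := fun j _ => G.pathLen_pos j
  refine ⟨hf, hl.root_lt, hl.lo_le, hl.hi_eq, hl.off_le, fun p u => hl.pos_next p u (Nat.zero_le _),
    fun p u => hl.root_next p u (Nat.zero_le _), fun p u => hl.off_next p u (Nat.zero_le _),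
    fun j => hl.entry j (Nat.zero_le _), Nat.zero_le _, ?_, ?_, ?_, fun t ht => by omega⟩
  · intro t ht
    -- Walking along the path from its first variable visits every position of the interval, since
    -- the path ends exactly at the upper bound of its root task.
    have key : ∀ e, G.field mem 11 t ≤ e → e < G.field mem 12 t →
        ∃ j, G.Reach j ∧ G.field mem 7 j = e ∧ G.field mem 8 j = t := by
      intro e he
      induction e, he using Nat.le_induction with
      | base => exact fun _ => hl.first t ht
      | succ e he ih =>
        intro hlt
        obtain ⟨j, hj, h1, h2⟩ := ih (by omega)
        have h3 := hl.hi_eq j hj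
        rcases hn : G.next j with _ | u
        · rw [pathLen_of_next_eq_zero hn, h2] at h3
          omega
        · exact ⟨u, hj.next hn, by rw [hl.pos_next j u (Nat.zero_le _) hj hn, h1],
            by rw [hl.root_next j u (Nat.zero_le _) hj hn, h2]⟩
    intro e h1 h2
    obtain ⟨j, hj, rfl, rfl⟩ := key e h1 h2
    rw [hl.entry j (Nat.zero_le _) hj]
    refine ⟨hj, rfl, fun h => ?_⟩
    rw [hl.hi_eq j hj] at h
    rcases hn : G.next j with _ | u
    · rw [pathLen_of_next_eq_zero hn] at h
      omega
    · rw [← hl.pos_next j u (Nat.zero_le _) hj hn, hl.entry u (Nat.zero_le _) (hj.next hn)]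
  · intro t ht
    obtain ⟨j, hj, h1, rfl⟩ := hl.first t ht
    rw [hl.hi_eq j hj]
    exact (hl.pos_le j hj).trans hm
  -- At the start there are at most `a` tasks covering `a` positions in total, which makes at most
  -- `3 * a`, and `a` is at most the number of variables.
  · have h1 := hl.sum
    have h2 := hl.tasks_le
    rw [Finset.range_eq_Ico] at h1
    omega

theorem Search.skip {T n : ℕ} {mem : ℕ → ℕ} (h : G.Search T n mem) (hT : T < n)
    (he : ¬G.field mem 11 T < G.field mem 12 T) : G.Search (T + 1) n mem := by
  have hp := h.potential
  rw [Finset.sum_eq_sum_Ico_succ_bot hT] at hp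
  refine ⟨h.1, h.2, h.3, h.4, h.5, h.6, h.7, h.8, h.9, hT, h.chain, h.hi_le, by omega, ?_⟩
  intro t ht hlt
  rcases Nat.lt_succ_iff_lt_or_eq.1 ht with ht | rfl
  exacts [h.divided t ht hlt, absurd hlt he]

/-- The dividing position `x` belongs to neither half. Thus the two new intervals together are one
shorter than the old one, which pays for the two new records; the records of earlier tasks stay as
they are. -/
theorem Search.split {T n x : ℕ} {mem mem' : ℕ → ℕ} (h : G.Search T n mem) (hT : T < n)
    (hlo : G.field mem 11 T ≤ x) (hhi : x < G.field mem 12 T)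
    (hx : 2 * G.nextLen (G.field mem 10 x) ≤
      G.middle mem (G.field mem 11 T) (G.field mem 12 T))
    (hx' : G.field mem 11 T < x → G.middle mem (G.field mem 11 T) (G.field mem 12 T) <
      2 * G.len (G.field mem 10 x))
    (hinput : G.HasInput mem')
    (hf : ∀ f z, f < 11 → G.field mem' f z = G.field mem f z)
    (h11 : ∀ t, G.field mem' 11 t = if t = n + 1 then x + 1 else if t = n then G.field mem 11 T
      else G.field mem 11 t)
    (h12 : ∀ t, G.field mem' 12 t = if t = n + 1 then G.field mem 12 T else if t = n then x
      else G.field mem 12 t)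
    (h13 : ∀ t, G.field mem' 13 t = if t = T then x else G.field mem 13 t)
    (h14 : ∀ t, G.field mem' 14 t = if t = T then n else G.field mem 14 t) :
    G.Search (T + 1) (n + 2) mem' := by
  have e7 := fun z => hf 7 z (by decide)
  have e8 := fun z => hf 8 z (by decide)
  have e9 := fun z => hf 9 z (by decide)
  have e10 := fun z => hf 10 z (by decide)
  have o11 : ∀ t < n, G.field mem' 11 t = G.field mem 11 t := fun t ht => by
    rw [h11, if_neg (by omega), if_neg (by omega)]
  have o12 : ∀ t < n, G.field mem' 12 t = G.field mem 12 t := fun t ht => by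
    rw [h12, if_neg (by omega), if_neg (by omega)]
  have n11 : G.field mem' 11 n = G.field mem 11 T := by rw [h11, if_neg (by omega), if_pos rfl]
  have n12 : G.field mem' 12 n = x := by rw [h12, if_neg (by omega), if_pos rfl]
  have m11 : G.field mem' 11 (n + 1) = x + 1 := by rw [h11, if_pos rfl]
  have m12 : G.field mem' 12 (n + 1) = G.field mem 12 T := by rw [h12, if_pos rfl]
  have hch : ∀ lo hi, G.Chain mem lo hi → G.Chain mem' lo hi := fun lo hi hc e h1 h2 => by
    simp only [e7, e10]
    exact hc e h1 h2
  have hcases : ∀ t, t < n + 2 → t < n ∨ t = n ∨ t = n + 1 := fun t ht => by omega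
  refine ⟨h.filled.congr hinput fun f z hf' => hf f z (by omega), ?_, ?_, ?_, ?_, ?_, ?_, ?_, ?_,
    by omega, ?_, ?_, ?_, ?_⟩
  · intro j hj
    rw [e8]
    exact (h.root_lt j hj).trans (by omega)
  · intro j hj
    rw [e8, e7, o11 _ (h.root_lt j hj)]
    exact h.lo_le j hj
  · intro j hj
    rw [e8, e7, o12 _ (h.root_lt j hj)]
    exact h.hi_eq j hj
  · simpa only [e9] using h.off_le
  · simpa only [e7] using h.pos_next
  · simpa only [e8] using h.root_next
  · simpa only [e9] using h.off_next
  · simpa only [e7, e10] using h.entry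
  · intro t ht
    rcases hcases t ht with ht | rfl | rfl
    · rw [o11 t ht, o12 t ht]
      exact hch _ _ (h.chain t ht)
    · rw [n11, n12]
      exact hch _ _ ((h.chain T hT).mono le_rfl hhi.le)
    · rw [m11, m12]
      exact hch _ _ ((h.chain T hT).mono (by omega) le_rfl)
  · intro t ht
    have hT' := h.hi_le T hT
    rcases hcases t ht with ht | rfl | rfl
    · rw [o12 t ht]
      exact h.hi_le t ht
    · rw [n12]
      omega
    · rwa [m12]
  · have hp := h.potential
    rw [Finset.sum_eq_sum_Ico_succ_bot hT] at hp
    have hs : ∑ t ∈ Finset.Ico (T + 1) n, (G.field mem' 12 t - G.field mem' 11 t) =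
        ∑ t ∈ Finset.Ico (T + 1) n, (G.field mem 12 t - G.field mem 11 t) :=
      Finset.sum_congr rfl fun t ht => by
        have := (Finset.mem_Ico.1 ht).2
        rw [o11 t this, o12 t this]
    rw [Finset.sum_Ico_succ_top (by omega), Finset.sum_Ico_succ_top (by omega), hs, n11, n12,
      m11, m12]
    omega
  · intro t ht hlt
    have htn : t < n := by omega
    rw [o11 t htn, o12 t htn] at hlt
    rcases Nat.lt_succ_iff_lt_or_eq.1 ht with ht | rfl
    · obtain ⟨d1, d2, d3, d4, d5, d6, d7, d8, d9⟩ := h.divided t ht hlt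
      have c13 : G.field mem' 13 t = G.field mem 13 t := by rw [h13, if_neg ht.ne]
      have c14 : G.field mem' 14 t = G.field mem 14 t := by rw [h14, if_neg ht.ne]
      have q1 := o11 _ (show G.field mem 14 t < n by omega)
      have q2 := o12 _ (show G.field mem 14 t < n by omega)
      have q3 := o11 _ d3
      have q4 := o12 _ d3
      constructor <;> simp only [c13, c14, o11 t htn, o12 t htn, e10, middle, q1, q2, q3, q4]
      · exact d1
      · exact d2
      · omega
      · exact d4
      · exact d5
      · exact d6
      · exact d7
      · exact d8
      · exact d9
    · have c13 : G.field mem' 13 t = x := by rw [h13, if_pos rfl]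
      have c14 : G.field mem' 14 t = n := by rw [h14, if_pos rfl]
      constructor <;>
        simp only [c13, c14, o11 t htn, o12 t htn, e10, middle, n11, n12, m11, m12]
      · exact hlo
      · exact hhi
      · omega
      · exact hx
      · exact hx'

theorem Search.lt {T n : ℕ} {mem : ℕ → ℕ} (h : G.Search T n mem) : n ≤ 3 * G.numVars :=
  le_trans (Nat.le_add_right _ _) h.potential

/-- The state of the binary search, with at most `2 ^ i` candidates. -/
structure BisectInv (G : SLP) (σ₀ : State) (lo hi i : ℕ) (σ : State) : Prop where
  mem_eq : σ.mem = σ₀.mem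
  reg0 : σ.reg 0 = σ₀.reg 0
  reg1 : σ.reg 1 = σ₀.reg 1
  reg3 : σ.reg 3 = σ₀.reg 3
  reg4 : σ.reg 4 = σ₀.reg 4
  reg5 : σ.reg 5 = σ₀.reg 5
  reg6 : σ.reg 6 = G.middle σ₀.mem lo hi
  lo_le : lo ≤ σ.reg 7
  le : σ.reg 7 ≤ σ.reg 8
  lt_hi : σ.reg 8 < hi
  lt_pow : σ.reg 8 - σ.reg 7 < 2 ^ i
  upper : 2 * G.nextLen (G.field σ₀.mem 10 (σ.reg 8)) ≤ G.middle σ₀.mem lo hi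
  lower : lo < σ.reg 7 →
    G.middle σ₀.mem lo hi < 2 * G.nextLen (G.field σ₀.mem 10 (σ.reg 7 - 1))

theorem bisectBody_spec (hw : G.Roomy w) {lo hi i : ℕ} {σ₀ σ : State}
    (h0 : σ₀.reg 0 = G.numVars) (hf : G.Filled G.numVars σ₀.mem) (hc : G.Chain σ₀.mem lo hi)
    (hhi : hi ≤ G.numVars) (h : BisectInv G σ₀ lo hi (i + 1) σ) (hlt : σ.reg 7 < σ.reg 8) :
    WP w (51 * G.numVars) bisectBody σ 0 fun t τ => t ≤ 100 ∧ BisectInv G σ₀ lo hi i τ := by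
  obtain ⟨g, g0, g1, g3, g4, g5, g6, g7, -, g8, g9, g10, g11⟩ := h
  have hw' := hw
  unfold Roomy at hw'
  obtain ⟨a, ha⟩ : ∃ a, σ.reg 7 = a := ⟨_, rfl⟩
  obtain ⟨b, hb⟩ : ∃ b, σ.reg 8 = b := ⟨_, rfl⟩
  rw [ha, hb] at hlt g9
  rw [ha] at g7 g11
  rw [hb] at g8 g10
  obtain ⟨x, hx⟩ : ∃ x, (a + b) / 2 = x := ⟨_, rfl⟩
  have hax : a ≤ x := by omega
  have hxb : x < b := by omega
  have hcx := (hc x (by omega) (by omega)).1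
  have i1 : x < 3 * G.numVars := by omega
  obtain ⟨k, hk⟩ : ∃ k, G.field σ₀.mem 10 x = k := ⟨_, rfl⟩
  have hk' : σ₀.mem (fieldAddr G.numVars 10 x) = k := hk
  rw [hk] at hcx
  have hk1 := hcx.1
  have i2 : k < 3 * G.numVars := by omega
  have n1 : σ₀.mem (fieldAddr G.numVars 4 k) = _ := hf.nextLen k hk1 hcx
  have n2 := nextLen_lt hk1
  have n3 := hcx.len_le
  rw [pow_succ] at g9
  simp [bisectBody, block, ha, hb, hx, g, g0, h0, g6, hk', n1, WordRAM.fieldAddr_lt,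
    hw.fieldAddr_lt, i1, i2]
  refine ⟨by omega, by omega, fun hm => ⟨by omega, ?_⟩, fun hm => ?_⟩
  · refine ⟨rfl, by simp [g0], by simp [g1], by simp [g3], by simp [g4], by simp [g5],
      by simp [g6], ?_, ?_, ?_, ?_, ?_, ?_⟩ <;> simp [hb, g8, g10, hk]
    all_goals omega
  · refine ⟨rfl, by simp [g0], by simp [g1], by simp [g3], by simp [g4], by simp [g5],
      by simp [g6], ?_, ?_, ?_, ?_, ?_, ?_⟩ <;> simp [ha, hk]
    all_goals omega

theorem bisectProg_spec (hw : G.Roomy w) {lo hi : ℕ} {σ : State}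
    (h0 : σ.reg 0 = G.numVars) (h4 : σ.reg 4 = lo) (h5 : σ.reg 5 = hi) (hlt : lo < hi)
    (hf : G.Filled G.numVars σ.mem) (hc : G.Chain σ.mem lo hi) (hhi : hi ≤ G.numVars) (t : ℕ) :
    WP w (51 * G.numVars) bisectProg σ t fun t' τ =>
      t' ≤ t + 110 * (Nat.log 2 G.numVars + 1) + 100 ∧
      (∀ r < 6, r ≠ 2 → τ.reg r = σ.reg r) ∧ τ.mem = σ.mem ∧
      lo ≤ τ.reg 7 ∧ τ.reg 7 < hi ∧
      2 * G.nextLen (G.field σ.mem 10 (τ.reg 7)) ≤ G.middle σ.mem lo hi ∧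
      (lo < τ.reg 7 → G.middle σ.mem lo hi < 2 * G.len (G.field σ.mem 10 (τ.reg 7))) := by
  have hw' := hw
  unfold Roomy at hw'
  have i1 : lo < 3 * G.numVars := by omega
  have i2 : hi - 1 < 3 * G.numVars := by omega
  have hc1 := (hc lo le_rfl hlt).1
  have hc2 := (hc (hi - 1) (by omega) (by omega)).1
  -- Monotonicity of lengths along the chain: it makes the last position a valid initial upper end
  -- of the binary search, and it bounds the middle by twice the length at `lo`.
  have hch : ∀ e, lo ≤ e → e < hi →
      G.nextLen (G.field σ.mem 10 e) ≤ G.len (G.field σ.mem 10 lo) := by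
    intro e he
    induction e, he using Nat.le_induction with
    | base => exact fun _ => (nextLen_lt hc1.1).le
    | succ e he ih =>
      intro h
      have h1 := ih (by omega)
      have h2 := nextLen_lt (hc (e + 1) (by omega) h).1.1
      rw [nextLen_of_next ((hc e he (by omega)).2.2 h)] at h1
      omega
  have hmid : G.middle σ.mem lo hi =
    G.len (G.field σ.mem 10 lo) + G.nextLen (G.field σ.mem 10 (hi - 1)) := rfl
  have hup := hch (hi - 1) (by omega) (by omega)
  obtain ⟨k, hk⟩ : ∃ k, G.field σ.mem 10 lo = k := ⟨_, rfl⟩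
  have hk' : σ.mem (fieldAddr G.numVars 10 lo) = k := hk
  obtain ⟨l, hl⟩ : ∃ l, G.field σ.mem 10 (hi - 1) = l := ⟨_, rfl⟩
  have hl' : σ.mem (fieldAddr G.numVars 10 (hi - 1)) = l := hl
  rw [hk] at hc1 hmid hup
  rw [hl] at hc2 hmid hup
  have hkm := hc1.1
  have hlm := hc2.1
  have i3 : k < 3 * G.numVars := by omega
  have i4 : l < 3 * G.numVars := by omega
  have n1 : σ.mem (fieldAddr G.numVars 1 k) = _ := hf.len k hkm hc1
  have n2 : σ.mem (fieldAddr G.numVars 4 l) = _ := hf.nextLen l hlm hc2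
  have b1 := hc1.len_le
  simp [bisectProg, block, h0, h4, h5, hk', hl', n1, n2, WordRAM.fieldAddr_lt,
    hw.fieldAddr_lt, i1, i2, i3, i4]
  refine ⟨by omega, ?_⟩
  refine WP.while (w := w) (by omega) 100 (BisectInv G σ lo hi) (fun _ _ _ => by simp) ?_
    (Nat.log 2 G.numVars + 1) ?_ ?_
  · intro n τ hI hcond
    have hlt' : τ.reg 7 < τ.reg 8 := by
      by_contra hlt'
      exact hcond (if_neg hlt')
    obtain _ | i := n
    · have := hI.lt_pow
      omega
    · exact ⟨i, rfl, bisectBody_spec hw h0 hf hc hhi hI hlt'⟩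
  · refine ⟨rfl, by simp, by simp, by simp, by simp, by simp, ?_, ?_, ?_, ?_, ?_, ?_, ?_⟩
    · simp [hmid]
    · simp
    · simp
      omega
    · simp
      omega
    · simp
      have := Nat.lt_pow_succ_log_self (b := 2) (by norm_num) G.numVars
      omega
    · simp [hl, hmid]
      omega
    · simp
  · rintro t' n τ ht ⟨g, g0, g1, g3, g4, g5, g6, g7, g8, g9, g10, g11, g12⟩ hcond
    have hle : ¬τ.reg 7 < τ.reg 8 := fun h => by simp [h] at hcond
    have heq : τ.reg 8 = τ.reg 7 := by omega
    rw [heq] at g9 g11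
    simp at ht
    refine ⟨by omega, fun r hr hr2 => ?_, g, g7, g9, g11, fun hlo => ?_⟩
    · interval_cases r <;> first | assumption | omega
    -- The position before the result fails the test, and its next length is the length at the
    -- result.
    · have h1 := g12 hlo
      have h2 := (hc (τ.reg 7 - 1) (by omega) (by omega)).2.2 (by omega)
      rw [nextLen_of_next h2, Nat.sub_add_cancel (by omega)] at h1
      exact h1

/-- The state before the processing of the task `T`. -/
structure SearchInv (G : SLP) (T : ℕ) (σ : State) : Prop where
  reg0 : σ.reg 0 = G.numVars
  reg1 : σ.reg 1 = T
  search : G.Search T (σ.reg 3) σ.mem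

theorem searchBody_spec (hw : G.Roomy w) {T : ℕ} {σ : State} (h : G.SearchInv T σ)
    (hT : T < σ.reg 3) :
    WP w (51 * G.numVars) searchBody σ 0 fun t τ =>
      t ≤ 110 * (Nat.log 2 G.numVars + 1) + 300 ∧ G.SearchInv (T + 1) τ := by
  obtain ⟨h0, h1, hs⟩ := h
  have hw' := hw
  unfold Roomy at hw'
  have hn := hs.lt
  have i1 : T < 3 * G.numVars := by omega
  obtain ⟨lo, hlo⟩ : ∃ x, G.field σ.mem 11 T = x := ⟨_, rfl⟩
  have hlo' : σ.mem (fieldAddr G.numVars 11 T) = lo := hlo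
  obtain ⟨hi, hhi⟩ : ∃ x, G.field σ.mem 12 T = x := ⟨_, rfl⟩
  have hhi' : σ.mem (fieldAddr G.numVars 12 T) = hi := hhi
  by_cases hlt : lo < hi
  · simp only [searchBody, block, wp_seq]
    simp [h0, h1, hlo', hhi', hlt, WordRAM.fieldAddr_lt, hw.fieldAddr_lt, i1]
    have hhm := hs.hi_le T hT
    have hc := hs.chain T hT
    rw [hhi] at hhm hc
    rw [hlo] at hc
    refine (bisectProg_spec hw (lo := lo) (hi := hi)
      (σ := ⟨Function.update (Function.update σ.reg 4 lo) 5 hi, σ.mem⟩)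
      (by simp [h0]) (by simp) (by simp) hlt hs.filled hc hhm _).mono ?_
    rintro t τ ⟨q, qr, qm, q1, q2, q3, q4⟩
    have r0 := qr 0 (by decide) (by decide)
    have r1 := qr 1 (by decide) (by decide)
    have r3 := qr 3 (by decide) (by decide)
    have r4 := qr 4 (by decide) (by decide)
    have r5 := qr 5 (by decide) (by decide)
    simp [h0, h1] at r0 r1 r3 r4 r5
    obtain ⟨x, hx⟩ : ∃ x, τ.reg 7 = x := ⟨_, rfl⟩
    rw [hx] at q1 q2 q3 q4
    simp only at qm q3 q4
    -- The interval of `T` is nonempty, so the potential leaves room for the two records that are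
    -- appended.
    have hsum : G.field σ.mem 12 T - G.field σ.mem 11 T ≤
        ∑ t ∈ Finset.Ico T (σ.reg 3), (G.field σ.mem 12 t - G.field σ.mem 11 t) :=
      Finset.single_le_sum (f := fun t => G.field σ.mem 12 t - G.field σ.mem 11 t)
        (fun _ _ => Nat.zero_le _) (Finset.mem_Ico.2 ⟨le_rfl, hT⟩)
    have hp := hs.potential
    rw [hlo, hhi] at hsum
    have i2 : σ.reg 3 < 3 * G.numVars := by omega
    have i3 : σ.reg 3 + 1 < 3 * G.numVars := by omega
    simp [splitBlock, block, r0, r1, r3, r4, r5, hx, WordRAM.fieldAddr_lt, hw.fieldAddr_lt, i1, i2,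
      i3]
    refine ⟨by omega, by omega, by omega, by omega, by omega, by simp [r0], by simp, ?_⟩
    simp [qm]
    refine hs.split (x := x) hT ?_ ?_ ?_ ?_ ?_ ?_ ?_ ?_ ?_ ?_
    · rwa [hlo]
    · rwa [hhi]
    · rwa [hlo, hhi]
    · rwa [hlo, hhi]
    · exact (((((hs.filled.input.update _ _ _).update _ _ _).update _ _ _).update _ _ _).update
        _ _ _).update _ _ _
    · intro f z hf
      simp [field_update, show f < 16 by omega, show f ≠ 11 by omega, show f ≠ 12 by omega,
        show f ≠ 13 by omega, show f ≠ 14 by omega]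
    all_goals intro z; simp [field_update, hlo, hhi]
  · simp [searchBody, block, h0, h1, hlo', hhi', hlt, WordRAM.fieldAddr_lt, hw.fieldAddr_lt, i1]
    refine fun _ => ⟨by omega, by simp [h0], by simp, ?_⟩
    simp
    exact hs.skip hT (by rwa [hlo, hhi])

/-- The memory after the preprocessing. -/
def Ready (G : SLP) (mem : ℕ → ℕ) : Prop :=
  ∃ n mem₀, G.Search n n mem₀ ∧ mem = Function.update mem₀ 2 G.numVars

theorem searchProg_spec (hw : G.Roomy w) {σ : State} (h : G.LayoutInv 0 σ) (t : ℕ) :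
    WP w (51 * G.numVars) searchProg σ t fun t' τ =>
      t' ≤ t + 3 * G.numVars * (110 * (Nat.log 2 G.numVars + 1) + 310) + 20 ∧
      G.Ready τ.mem := by
  have hw' := hw
  unfold Roomy at hw'
  have hm := G.numVars_pos
  simp [searchProg, block]
  refine WP.while (w := w) (by omega) (110 * (Nat.log 2 G.numVars + 1) + 300)
    (fun n τ => n ≤ 3 * G.numVars ∧ G.SearchInv (3 * G.numVars - n) τ)
    (fun _ _ _ => by simp) ?_ (3 * G.numVars) ⟨le_rfl, ?_⟩ ?_
  · rintro n τ ⟨hn, hI⟩ hc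
    have hlt : τ.reg 1 < τ.reg 3 := by
      by_contra hlt
      exact hc (if_neg hlt)
    have hle := hI.search.lt
    rw [hI.reg1] at hlt
    refine ⟨n - 1, by omega, (searchBody_spec hw hI hlt).mono fun t τ hτ => ⟨hτ.1, by omega, ?_⟩⟩
    convert hτ.2 using 1
    omega
  · rw [Nat.sub_self]
    exact ⟨by simp [h.reg0], by simp, by simpa using h.layout.search h.filled⟩
  · rintro t' n τ ht ⟨hn, hI⟩ hc
    have hge : ¬τ.reg 1 < τ.reg 3 := fun h => by simp [h] at hc
    have hle := hI.search.le
    rw [hI.reg1] at hge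
    have heq : 3 * G.numVars - n = τ.reg 3 := by omega
    have hs := hI.search
    rw [heq] at hs
    simp [hI.reg0]
    refine ⟨by omega, ?_, _, _, hs, rfl⟩
    simp at ht
    have : 3 * G.numVars * (110 * (Nat.log 2 G.numVars + 1) + 300 + 3 + 1) ≤
      3 * G.numVars * (110 * (Nat.log 2 G.numVars + 1) + 310) :=
        Nat.mul_le_mul_left _ (by omega)
    omega

/-! ### Queries: the search for the exit of a path -/

/-- The position `y` of the string of a path lies in the part that the variable `j` generates. -/
def Covers (G : SLP) (mem : ℕ → ℕ) (j y : ℕ) : Prop :=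
  G.field mem 9 j ≤ y ∧ y < G.field mem 9 j + G.len j

/-- The last variable of a path that covers the position `y`. -/
structure Exit (G : SLP) (mem : ℕ → ℕ) (j y : ℕ) : Prop where
  reach : G.Reach j
  covers : G.Covers mem j y
  not_next : ∀ u, G.next j = u + 1 → ¬G.Covers mem u y

/-- The variable `j` has a position in the range of the task `t`. -/
structure InTask (G : SLP) (n : ℕ) (mem : ℕ → ℕ) (t j : ℕ) : Prop where
  lt : t < n
  lo_le : G.field mem 11 t ≤ G.field mem 7 j
  lt_hi : G.field mem 7 j < G.field mem 12 t

/-- The total length of the parts that leave a path at the positions from `lo` to `hi - 1`. -/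
def weight (G : SLP) (mem : ℕ → ℕ) (lo hi : ℕ) : ℕ :=
  G.len (G.field mem 10 lo) - G.nextLen (G.field mem 10 (hi - 1))

/-- A bound for the number of times that the number of occurrences can double. -/
def room (G : SLP) (k : ℕ) : ℕ := Nat.log 2 (G.word.length / G.occ k)

theorem room_anti {j k : ℕ} (hj : G.Reach j) (h : G.occ j ≤ G.occ k) : G.room k ≤ G.room j :=
  Nat.log_mono_right (Nat.div_le_div_left h hj.2)

theorem room_lt {j k : ℕ} (hj : G.Reach j) (hk : G.Reach k) (h : 2 * G.occ j ≤ G.occ k) :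
    G.room k + 1 ≤ G.room j := by
  have h1 : 0 < G.word.length / G.occ k := Nat.div_pos (occ_le hk.1) hk.2
  rw [room, ← Nat.log_mul_base (by norm_num) h1.ne']
  refine Nat.log_mono_right ((Nat.le_div_iff_mul_le hj.2).2 ?_)
  calc G.word.length / G.occ k * 2 * G.occ j = G.word.length / G.occ k * (2 * G.occ j) := by ring
    _ ≤ G.word.length / G.occ k * G.occ k := Nat.mul_le_mul_left _ h
    _ ≤ G.word.length := Nat.div_mul_le_self _ _

theorem Chain.level_eq {mem : ℕ → ℕ} {lo hi : ℕ} (hc : G.Chain mem lo hi) {e : ℕ} (he : lo ≤ e)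
    (h : e < hi) : G.level (G.field mem 10 e) = G.level (G.field mem 10 lo) := by
  induction e, he using Nat.le_induction with
  | base => rfl
  | succ e he ih => rw [← ih (by omega), (isChild_of_next ((hc e he (by omega)).2.2 h)).2.1]

theorem Chain.len_succ {mem : ℕ → ℕ} {lo hi : ℕ} (hc : G.Chain mem lo hi) {e : ℕ} (he : lo ≤ e)
    (h : e + 1 < hi) : G.nextLen (G.field mem 10 e) = G.len (G.field mem 10 (e + 1)) :=
  nextLen_of_next ((hc e he (by omega)).2.2 h)

theorem Chain.len_le {mem : ℕ → ℕ} {lo hi : ℕ} (hc : G.Chain mem lo hi) {e e' : ℕ} (he : lo ≤ e)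
    (hee : e ≤ e') (h : e' < hi) : G.len (G.field mem 10 e') ≤ G.len (G.field mem 10 e) := by
  induction e', hee using Nat.le_induction with
  | base => rfl
  | succ e' hee ih =>
    have h1 := ih (by omega)
    have h2 := nextLen_lt (hc e' (by omega) (by omega)).1.1
    rw [hc.len_succ (by omega) h] at h2
    omega

/-- The weight is the telescoping sum of the lengths that leave the path at the positions of the
interval; the left-hand side is one summand. -/
theorem Chain.le_weight {mem : ℕ → ℕ} {lo hi : ℕ} (hc : G.Chain mem lo hi) {e : ℕ} (he : lo ≤ e)
    (h : e < hi) :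
    G.len (G.field mem 10 e) - G.nextLen (G.field mem 10 e) ≤ G.weight mem lo hi := by
  have h1 := hc.len_le le_rfl he h
  have h2 : G.nextLen (G.field mem 10 (hi - 1)) ≤ G.nextLen (G.field mem 10 e) := by
    rcases (show e ≤ hi - 1 by omega).lt_or_eq with h' | h'
    · rw [hc.len_succ he (by omega)]
      exact (nextLen_lt (hc (hi - 1) (by omega) (by omega)).1.1).le.trans
        (hc.len_le (by omega) (by omega) (by omega))
    · rw [h']
  unfold weight
  omega

/-! ### Descent inside a path and passage to the next path -/

namespace Search

variable {n : ℕ} {mem : ℕ → ℕ}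

theorem covers_of_next (hs : G.Search n n mem) {j u y : ℕ} (hj : G.Reach j) (hn : G.next j = u + 1)
    (h : G.Covers mem u y) : G.Covers mem j y := by
  have h1 := hs.off_next j u hj hn
  have h2 := (isChild_of_next hn).1
  have h3 := len_of_tag_one hj.1 h2.1
  unfold Covers at *
  split at h1
  · next he =>
    rw [← he] at h3
    omega
  · next he =>
    rw [← h2.2.resolve_left he] at h3
    omega

theorem getElem?_next (hs : G.Search n n mem) {j u y : ℕ} (hj : G.Reach j) (hn : G.next j = u + 1)
    (h : G.Covers mem u y) :
    (G.str j)[y - G.field mem 9 j]? = (G.str u)[y - G.field mem 9 u]? := by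
  have h1 := hs.off_next j u hj hn
  have h2 := (isChild_of_next hn).1
  rw [str_of_tag_one hj.1 h2.1]
  unfold Covers len at h
  split at h1
  · next he =>
    rw [List.getElem?_append_left (by rw [← he]; omega), ← he, h1, add_zero]
  · next he =>
    have h3 := h2.2.resolve_left he
    unfold len at h1
    rw [List.getElem?_append_right (by omega), ← h3]
    congr 1
    omega

/-- Follow the path as long as the successor covers the position. The root task and the level stay
the same, the number of occurrences does not decrease, and the symbol addressed is unchanged. -/
theorem exists_exit (hs : G.Search n n mem) {v y : ℕ} (hv : G.Reach v) (hy : G.Covers mem v y) :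
    ∃ x, G.Exit mem x y ∧ G.field mem 8 x = G.field mem 8 v ∧
      G.field mem 7 v ≤ G.field mem 7 x ∧ G.level x = G.level v ∧ G.occ v ≤ G.occ x ∧
      (G.str x)[y - G.field mem 9 x]? = (G.str v)[y - G.field mem 9 v]? := by
  induction v using Nat.strong_induction_on with
  | _ v ih =>
    by_cases hex : ∃ u, G.next v = u + 1 ∧ G.Covers mem u y
    · obtain ⟨u, hn, hu⟩ := hex
      obtain ⟨x, h1, h2, h3, h4, h5, h6⟩ := ih u (next_lt hv.1 hn) (hv.next hn) hu
      have hc := isChild_of_next hn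
      refine ⟨x, h1, h2.trans (hs.root_next v u hv hn), ?_, h4.trans hc.2.1,
        (hc.1.occ_le hv.1).trans h5, h6.trans (hs.getElem?_next hv hn hu).symm⟩
      rw [hs.pos_next v u hv hn] at h3
      omega
    · exact ⟨v, ⟨hv, hy, fun u hn hu => hex ⟨u, hn, hu⟩⟩, rfl, le_rfl, rfl, le_rfl, rfl⟩

theorem inTask_root (hs : G.Search n n mem) {x : ℕ} (hx : G.Reach x) :
    G.InTask n mem (G.field mem 8 x) x := by
  refine ⟨hs.root_lt x hx, hs.lo_le x hx, ?_⟩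
  rw [hs.hi_eq x hx]
  have := G.pathLen_pos x
  omega

theorem covers_of_le (hs : G.Search n n mem) {lo hi : ℕ} (hc : G.Chain mem lo hi)
    {e e' y : ℕ} (he : lo ≤ e)
    (hee : e ≤ e') (h : e' < hi) (hy : G.Covers mem (G.field mem 10 e') y) :
    G.Covers mem (G.field mem 10 e) y := by
  induction e', hee using Nat.le_induction with
  | base => exact hy
  | succ e' hee ih =>
    have h1 := hc e' (by omega) (by omega)
    exact ih (by omega) (hs.covers_of_next h1.1 (h1.2.2 h) hy)

/-- One step of the descent in the search tree of a path. -/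
theorem descend (hs : G.Search n n mem) {t x y : ℕ} (hx : G.Exit mem x y)
    (ht : G.InTask n mem t x) :
    G.Divided n mem t ∧
    (G.field mem 7 x = G.field mem 13 t ∨
    (¬G.Covers mem (G.field mem 10 (G.field mem 13 t)) y ∧
      G.InTask n mem (G.field mem 14 t) x ∧
      Nat.log 2 (G.weight mem (G.field mem 11 (G.field mem 14 t))
        (G.field mem 12 (G.field mem 14 t))) + 1 ≤
        Nat.log 2 (G.weight mem (G.field mem 11 t) (G.field mem 12 t))) ∨
    (∃ u, G.Covers mem (G.field mem 10 (G.field mem 13 t)) y ∧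
      G.next (G.field mem 10 (G.field mem 13 t)) = u + 1 ∧ G.Covers mem u y ∧
      G.InTask n mem (G.field mem 14 t + 1) x ∧
      Nat.log 2 (G.weight mem (G.field mem 11 (G.field mem 14 t + 1))
        (G.field mem 12 (G.field mem 14 t + 1))) + 1 ≤
        Nat.log 2 (G.weight mem (G.field mem 11 t) (G.field mem 12 t)))) := by
  obtain ⟨htn, hlo, hhi⟩ := ht
  have hd := hs.divided t htn (by omega)
  refine ⟨hd, ?_⟩
  obtain ⟨d1, d2, d3, d4, d5, d6, d7, d8, d9⟩ := hd
  have hc := hs.chain t htn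
  rw [d4, d5, d6, d7]
  generalize G.field mem 14 t = c at *
  generalize G.field mem 13 t = e at *
  generalize G.field mem 11 t = lo at *
  generalize G.field mem 12 t = hi at *
  have hent := hs.entry x hx.reach
  obtain ⟨p, hp⟩ : ∃ p, G.field mem 7 x = p := ⟨_, rfl⟩
  rw [hp] at hent hlo hhi ⊢
  have hlen : G.nextLen (G.field mem 10 (hi - 1)) ≤ G.len (G.field mem 10 lo) :=
    (nextLen_lt (hc (hi - 1) (by omega) (by omega)).1.1).le.trans
      (hc.len_le le_rfl (by omega) (by omega))
  -- Halving lowers the logarithm only for a positive weight; the smaller interval contains the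
  -- position of `x`, where some length leaves the path.
  have hhalf : ∀ lo' hi', G.Chain mem lo' hi' → lo' ≤ p → p < hi' →
      2 * G.weight mem lo' hi' ≤ G.weight mem lo hi →
      Nat.log 2 (G.weight mem lo' hi') + 1 ≤ Nat.log 2 (G.weight mem lo hi) := by
    intro lo' hi' hc' h1 h2 h3
    have h4 := hc'.le_weight h1 h2
    have h5 := nextLen_lt (hc' p h1 h2).1.1
    rw [← Nat.log_mul_base (by norm_num) (by omega)]
    exact Nat.log_mono_right (by omega)
  -- If the exit lies before the dividing position, the variable there does not cover `y`; if it
  -- lies behind, even the successor of that variable does. These are the two tests that a query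
  -- makes.
  rcases lt_trichotomy p e with hpe | hpe | hpe
  · right; left
    refine ⟨fun hy => ?_, ⟨by omega, by omega, by omega⟩, ?_⟩
    · have h1 := hs.covers_of_le hc (e := p + 1) (by omega) hpe d2 hy
      have h2 := (hc p hlo hhi).2.2 (by omega)
      rw [hent] at h2
      exact hx.not_next _ h2 h1
    · refine hhalf lo e (hc.mono le_rfl d2.le) hlo hpe ?_
      have h1 := d9 (by omega)
      have h2 := hc.len_succ (e := e - 1) (by omega) (by omega)
      rw [Nat.sub_add_cancel (by omega)] at h2
      unfold weight middle at *
      omega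
  · exact .inl hpe
  · right; right
    have h1 := (hc e d1 d2).2.2 (by omega)
    have h2 : G.Covers mem (G.field mem 10 p) y := hent ▸ hx.covers
    refine ⟨_, hs.covers_of_le hc d1 hpe.le hhi h2, h1,
      hs.covers_of_le hc (by omega) hpe hhi h2, ⟨by omega, by omega, by omega⟩, ?_⟩
    refine hhalf (e + 1) hi (hc.mono (by omega) le_rfl) hpe hhi ?_
    have h3 := hc.len_succ (e := e) d1 (by omega)
    unfold weight middle at *
    omega

/-- The variable at which the search continues after the exit from a path. -/
theorem continue_search (hs : G.Search n n mem) {t x y z : ℕ} (hx : G.Exit mem x y)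
    (ht : G.InTask n mem t x)
    (htag : G.tag x = 1)
    (hz : z = if y - G.field mem 9 x < G.len (G.fst x) then G.fst x else G.snd x) (y' : ℕ)
    (hy' : y' = G.field mem 9 z + (y - G.field mem 9 x -
      if y - G.field mem 9 x < G.len (G.fst x) then 0 else G.len (G.fst x))) :
    ∃ x', G.Exit mem x' y' ∧ G.InTask n mem (G.field mem 8 z) x' ∧
      (G.str x')[y' - G.field mem 9 x']? = (G.str x)[y - G.field mem 9 x]? ∧
      Nat.log 2 (G.weight mem (G.field mem 11 (G.field mem 8 z))
        (G.field mem 12 (G.field mem 8 z))) + G.level x' + G.room x' + 1 ≤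
      Nat.log 2 (G.weight mem (G.field mem 11 t) (G.field mem 12 t)) + G.level x + G.room x := by
  have hr := hx.reach
  have hcov := hx.covers
  unfold Covers at hcov
  have hlen := len_of_tag_one hr.1 htag
  have hchild : G.IsChild x z := ⟨htag, by rw [hz]; split <;> simp⟩
  have hrz := hr.child hchild
  have hcz : G.Covers mem z y' := by
    unfold Covers
    split at hz <;> simp_all
    omega
  have hstr : (G.str z)[y' - G.field mem 9 z]? = (G.str x)[y - G.field mem 9 x]? := by
    rw [str_of_tag_one hr.1 htag, hy', Nat.add_sub_cancel_left]
    unfold len at hz ⊢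
    split at hz
    · next hlt => rw [if_pos hlt, hz, List.getElem?_append_left hlt, Nat.sub_zero]
    · next hlt => rw [if_neg hlt, hz, List.getElem?_append_right (by omega)]
  -- The child `z` contains the position, whereas by the definition of an exit the successor of `x`
  -- does not.
  have hnz : G.next x ≠ z + 1 := by
    intro hn
    refine hx.not_next z hn ?_
    have h1 := hs.off_next x z hr hn
    have h2 := fst_ne_snd_of_next hr.1 hn
    unfold Covers
    split at hz
    · rw [hz] at h1 ⊢
      rw [if_pos rfl] at h1
      omega
    · rw [hz] at h1 ⊢
      rw [if_neg h2.symm] at h1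
      omega
  obtain ⟨x', h1, h2, h3, h4, h5, h6⟩ := hs.exists_exit hrz hcz
  have hroot := hs.inTask_root hrz
  have hroot' := hs.inTask_root h1.reach
  rw [h2] at hroot'
  refine ⟨x', h1, hroot', h6.trans hstr, ?_⟩
  -- The weight of a whole path is at most the length of its first variable, which has the level of
  -- `z`.
  have hw1 : Nat.log 2 (G.weight mem (G.field mem 11 (G.field mem 8 z))
      (G.field mem 12 (G.field mem 8 z))) ≤ G.level z := by
    have hc := hs.chain _ hroot.lt
    have hl := hc.level_eq hroot.lo_le hroot.lt_hi
    rw [hs.entry z hrz] at hl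
    rw [hl]
    exact Nat.log_mono_right (Nat.sub_le _ _)
  -- The string of `z` is part of what leaves the path at `x`, hence of the weight of the task `t`.
  have hw2 : G.level z ≤ Nat.log 2 (G.weight mem (G.field mem 11 t) (G.field mem 12 t)) := by
    refine Nat.log_mono_right (le_trans ?_ ((hs.chain t ht.lt).le_weight ht.lo_le ht.lt_hi))
    rw [hs.entry x hr]
    rcases hn : G.next x with _ | u
    · rw [nextLen_of_next_eq_zero hn]
      exact len_child_le hr.1 hchild
    · rw [nextLen_of_next hn, hlen]
      have hne : z ≠ u := fun he => hnz (he ▸ hn)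
      rcases hchild.2 with h | h <;> rcases (isChild_of_next hn).1.2 with h' | h' <;>
        first
        | exact absurd (h.trans h'.symm) hne
        | rw [← h, ← h']
          omega
  have hroom := room_anti hrz h5
  have hroom' := room_anti hr (hchild.occ_le hr.1)
  have hlev := level_child_le hr.1 hchild
  rcases light_child hr.1 hchild hnz with h | h
  -- By `hw1` and `hw2` the first summand does not grow. Neither do the level and the room, and one
  -- of these two drops since the edge to `z` is not on a path.
  · omega
  · have := room_lt hr hrz h
    omega

end Search

/-! ### The query program -/

/-- The step from the last variable of a path that covers the position to one of its children. -/
def exitBlock : Prog :=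
  .ite (load (const 3 * reg 6))
    (block [
      .assign 7 (load (const 3 * reg 6 + const 1)),
      .assign 3 (reg 3 - fieldExpr 9 (reg 6)),
      .ite (.op .lt (reg 3) (fieldExpr 1 (reg 7)))
        .skip
        (block [
          .assign 3 (reg 3 - fieldExpr 1 (reg 7)),
          .assign 7 (load (const 3 * reg 6 + const 2))]),
      .assign 2 (fieldExpr 8 (reg 7)),
      .assign 3 (fieldExpr 9 (reg 7) + reg 3)])
    (block [
      .assign 5 (load (const 3 * reg 6 + const 1)),
      .assign 4 (const 0)])

def queryBody : Prog :=
  block [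
    .assign 6 (fieldExpr 10 (fieldExpr 13 (reg 2))),
    .ite (.op .lt (reg 3) (fieldExpr 9 (reg 6)))
      (.assign 2 (fieldExpr 14 (reg 2)))
      (.ite (.op .lt (reg 3) (fieldExpr 9 (reg 6) + fieldExpr 1 (reg 6)))
        (block [
          .assign 7 (fieldExpr 3 (reg 6)),
          .ite (reg 7)
            (block [
              .assign 7 (reg 7 - const 1),
              .ite (.op .lt (reg 3) (fieldExpr 9 (reg 7)))
                exitBlock
                (.ite (.op .lt (reg 3) (fieldExpr 9 (reg 7) + fieldExpr 1 (reg 7)))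
                  (.assign 2 (fieldExpr 14 (reg 2) + const 1))
                  exitBlock)])
            exitBlock])
        (.assign 2 (fieldExpr 14 (reg 2))))]

/-- The program that answers a query. -/
def queryProg : Prog :=
  block [
    .assign 1 (reg 0),
    .assign 0 (load (const 2)),
    .assign 2 (fieldExpr 8 (reg 0 - const 1)),
    .assign 3 (reg 1 - const 1 + fieldExpr 9 (reg 0 - const 1)),
    .assign 4 (const 1),
    .while (reg 4) queryBody,
    .assign 0 (reg 5)]

/-- The state during a query, with at most `i` further steps. -/
structure QueryInv (G : SLP) (n : ℕ) (mem₀ : ℕ → ℕ) (ans i : ℕ) (σ : State) : Prop where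
  mem_eq : σ.mem = Function.update mem₀ 2 G.numVars
  reg0 : σ.reg 0 = G.numVars
  search : (σ.reg 4 = 0 ∧ σ.reg 5 = ans) ∨ (σ.reg 4 = 1 ∧
    ∃ x, G.Exit mem₀ x (σ.reg 3) ∧ G.InTask n mem₀ (σ.reg 2) x ∧
      (G.str x)[σ.reg 3 - G.field mem₀ 9 x]? = some ans ∧
      Nat.log 2 (G.weight mem₀ (G.field mem₀ 11 (σ.reg 2)) (G.field mem₀ 12 (σ.reg 2))) +
        G.level x + G.room x + 1 ≤ i)

/-- Cell 2 belongs to the input, so the number saved there leaves all records intact. -/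
theorem read_field {mem mem₀ : ℕ → ℕ} (h : mem = Function.update mem₀ 2 G.numVars) (f k : ℕ) :
    mem (fieldAddr G.numVars f k) = G.field mem₀ f k := by
  have := G.numVars_pos
  rw [h, Function.update_of_ne (by unfold fieldAddr; omega), field]

theorem exitBlock_spec (hw : G.Roomy w) {n t x y ans i : ℕ} {mem₀ : ℕ → ℕ} {σ : State}
    (hs : G.Search n n mem₀) (hmem : σ.mem = Function.update mem₀ 2 G.numVars)
    (h0 : σ.reg 0 = G.numVars) (h3 : σ.reg 3 = y) (h4 : σ.reg 4 = 1) (h6 : σ.reg 6 = x)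
    (hx : G.Exit mem₀ x y) (ht : G.InTask n mem₀ t x)
    (hans : (G.str x)[y - G.field mem₀ 9 x]? = some ans)
    (hi : Nat.log 2 (G.weight mem₀ (G.field mem₀ 11 t) (G.field mem₀ 12 t)) +
        G.level x + G.room x ≤ i) (T : ℕ) :
    WP w (51 * G.numVars) exitBlock σ T fun t' τ => t' ≤ T + 120 ∧ G.QueryInv n mem₀ ans i τ := by
  have hw' := hw
  unfold Roomy at hw'
  have hr := hx.reach
  have hxm := hr.1
  have hcov := hx.covers
  have hoff := hs.off_le x hr
  unfold Covers at hcov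
  have hfld := read_field hmem
  have e0 : σ.mem (3 * x) = G.tag x := by
    rw [hmem, Function.update_of_ne (by omega), hs.filled.input.tag hxm]
  have e1 : σ.mem (3 * x + 1) = G.fst x := by
    rw [hmem, Function.update_of_ne (by omega), hs.filled.input.fst hxm]
  have i1 : x < 3 * G.numVars := by omega
  rcases tag_eq hxm with htag | htag
  · simp [exitBlock, block, h0, h6, e0, e1, htag]
    refine ⟨by omega, by omega, ⟨hmem, by simp [h0], .inl ⟨by simp, ?_⟩⟩⟩
    have hlen := len_of_tag_zero hxm htag
    rw [str_of_tag_zero hxm htag, show y - G.field mem₀ 9 x = 0 by omega] at hans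
    simpa using hans
  · have l1 := fst_lt hxm htag
    have l2 := snd_lt hxm htag
    have r1 : G.Reach (G.fst x) := hr.child ⟨htag, .inl rfl⟩
    have r2 : G.Reach (G.snd x) := hr.child ⟨htag, .inr rfl⟩
    -- A variable with a pair rule is not the first one, so its third word is not the overwritten
    -- cell 2.
    have e2 : σ.mem (3 * x + 2) = G.snd x := by
      rw [hmem, Function.update_of_ne (by omega), hs.filled.input.snd hxm]
    have n1 := hs.filled.len _ r1.1 r1
    have i2 : G.fst x < 3 * G.numVars := by omega
    have i3 : G.snd x < 3 * G.numVars := by omega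
    have o1 := hs.off_le _ r1
    have o2 := hs.off_le _ r2
    have hlen := len_of_tag_one hxm htag
    have hcont := hs.continue_search hx ht htag rfl _ rfl
    simp [exitBlock, block, h0, h3, h6, e0, e1, e2, htag, hfld, n1, WordRAM.fieldAddr_lt,
      hw.fieldAddr_lt, i1, i2, i3]
    refine ⟨by omega, by omega, fun hlt => ⟨by omega, ?_⟩, fun hlt => ⟨by omega, by omega, ?_⟩⟩
    · refine ⟨hmem, by simp [h0], .inr ⟨by simp [h4], ?_⟩⟩
      rw [if_pos hlt, if_pos hlt] at hcont
      obtain ⟨x', q1, q2, q3, q4⟩ := hcont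
      exact ⟨x', by simpa using q1, by simpa using q2, by simpa [hans] using q3,
        by simpa using q4.trans hi⟩
    · refine ⟨hmem, by simp [h0], .inr ⟨by simp [h4], ?_⟩⟩
      rw [if_neg (by omega), if_neg (by omega)] at hcont
      obtain ⟨x', q1, q2, q3, q4⟩ := hcont
      exact ⟨x', by simpa using q1, by simpa using q2, by simpa [hans] using q3,
        by simpa using q4.trans hi⟩

theorem queryBody_spec (hw : G.Roomy w) {n ans i : ℕ} {mem₀ : ℕ → ℕ} {σ : State}
    (hs : G.Search n n mem₀) (h : G.QueryInv n mem₀ ans i σ) (hrun : σ.reg 4 ≠ 0) :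
    ∃ i', i = i' + 1 ∧ WP w (51 * G.numVars) queryBody σ 0 fun t τ =>
      t ≤ 250 ∧ G.QueryInv n mem₀ ans i' τ := by
  obtain ⟨hmem, h0, ⟨h4, -⟩ | ⟨h4, x, hx, ht, hans, hi⟩⟩ := h
  · exact absurd h4 hrun
  obtain ⟨i, rfl⟩ : ∃ i', i = i' + 1 := ⟨i - 1, by omega⟩
  refine ⟨i, rfl, ?_⟩
  have hw' := hw
  unfold Roomy at hw'
  have hn := hs.lt
  have hfld := read_field hmem
  obtain ⟨t, h2⟩ : ∃ t, σ.reg 2 = t := ⟨_, rfl⟩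
  obtain ⟨y, h3⟩ : ∃ y, σ.reg 3 = y := ⟨_, rfl⟩
  rw [h2] at ht hi
  rw [h3] at hx hans
  obtain ⟨hd, hstep⟩ := hs.descend hx ht
  have htn := ht.lt
  have hhm := hs.hi_le t htn
  have hv := hs.chain t htn (G.field mem₀ 13 t) hd.lo_le hd.lt_hi
  have d2 := hd.lt_hi
  have d3 := hd.child_lt
  have hent := hs.entry x hx.reach
  obtain ⟨e, he⟩ : ∃ e, G.field mem₀ 13 t = e := ⟨_, rfl⟩
  obtain ⟨c, hc⟩ : ∃ c, G.field mem₀ 14 t = c := ⟨_, rfl⟩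
  rw [he] at hstep hv d2
  rw [hc] at hstep d3
  obtain ⟨v, hve⟩ : ∃ v, G.field mem₀ 10 e = v := ⟨_, rfl⟩
  rw [hve] at hstep hv
  have hrv := hv.1
  have hvm := hrv.1
  have n1 := hs.filled.len v hvm hrv
  have n3 := hs.filled.next v hvm hrv
  have hoff := hs.off_le v hrv
  have i1 : t < 3 * G.numVars := by omega
  have i2 : e < 3 * G.numVars := by omega
  have i3 : v < 3 * G.numVars := by omega
  rcases hstep with hpe | ⟨hnc, htask, hlog⟩ | ⟨u, hcv, hnu, hcu, htask, hlog⟩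
  · rw [hpe, hve] at hent
    subst hent
    have hcov := hx.covers
    unfold Covers at hcov
    have hcov1 : ¬y < G.field mem₀ 9 v := by omega
    have hexit : ∀ r T, T ≤ 120 → WP w (51 * G.numVars) exitBlock
        ⟨Function.update (Function.update σ.reg 6 v) 7 r, σ.mem⟩ T
        fun t τ => t + 1 + 1 < 250 ∧ G.QueryInv n mem₀ ans i τ := fun r T hT =>
      (exitBlock_spec hw (y := y) (t := t) (i := i)
        (σ := ⟨Function.update (Function.update σ.reg 6 v) 7 r, σ.mem⟩) hs hmem (by simp [h0])
        (by simp [h3]) (by simp [h4]) (by simp) hx ht hans (by omega) T).mono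
        fun t τ ⟨q1, q2⟩ => ⟨by omega, q2⟩
    rcases hnx : G.next v with _ | u
    · simp [queryBody, block, h0, h2, h3, he, hve, hfld, n1, n3, hnx, hcov1, hcov.2,
        WordRAM.fieldAddr_lt, hw.fieldAddr_lt, i1, i2, i3]
      exact ⟨by omega, (hexit 0 _ (by norm_num)).mono fun t τ ⟨q1, q2⟩ => ⟨by omega, q2⟩⟩
    · have hru := hrv.next hnx
      have hncu := hx.not_next u hnx
      have hum := hru.1
      have i4 : u < 3 * G.numVars := by omega
      have n4 := hs.filled.len u hum hru
      have hoffu := hs.off_le u hru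
      unfold Covers at hncu
      simp [queryBody, block, h0, h2, h3, he, hve, hfld, n1, n3, n4, hnx, hcov1, hcov.2,
        WordRAM.fieldAddr_lt, hw.fieldAddr_lt, i1, i2, i3, i4]
      exact ⟨by omega, fun _ => hexit u _ (by norm_num), fun _ => ⟨by omega,
        fun _ => absurd ⟨by omega, by omega⟩ hncu, fun _ => hexit u _ (by norm_num)⟩⟩
  · unfold Covers at hnc
    simp [queryBody, block, h0, h2, h3, he, hc, hve, hfld, n1, n3,
      WordRAM.fieldAddr_lt, hw.fieldAddr_lt, i1, i2, i3]
    have hleft : G.QueryInv n mem₀ ans i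
        ⟨Function.update (Function.update σ.reg 6 v) 2 c, σ.mem⟩ := by
      refine ⟨hmem, by simp [h0], .inr ⟨by simp [h4], x, ?_⟩⟩
      simp [h3]
      exact ⟨hx, htask, hans, by omega⟩
    exact ⟨fun _ => hleft, fun _ => ⟨by omega, fun _ => absurd ⟨by omega, by omega⟩ hnc,
      fun _ => hleft⟩⟩
  · have hru := hrv.next hnu
    have hum := hru.1
    have i4 : u < 3 * G.numVars := by omega
    have n4 := hs.filled.len u hum hru
    have hoffu := hs.off_le u hru
    unfold Covers at hcv hcu
    have hcv1 : ¬y < G.field mem₀ 9 v := by omega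
    have hcu1 : ¬y < G.field mem₀ 9 u := by omega
    simp [queryBody, block, h0, h2, h3, he, hc, hve, hfld, n1, n3, n4, hnu, hcv1, hcv.2, hcu1,
      hcu.2, WordRAM.fieldAddr_lt, hw.fieldAddr_lt, i1, i2, i3, i4]
    refine ⟨by omega, fun _ => ⟨by omega, by omega, hmem, by simp [h0],
      .inr ⟨by simp [h4], x, ?_⟩⟩⟩
    simp [h3]
    exact ⟨hx, htask, hans, by omega⟩

theorem queryProg_spec (hw : G.Roomy w) {mem : ℕ → ℕ} (h : G.Ready mem)
    (j : Fin G.word.length) :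
    WP w (51 * G.numVars) queryProg (start (j.val + 1) mem) 0 fun t τ =>
      t ≤ 260 * (3 * Nat.log 2 G.word.length + 1) + 100 ∧ τ.reg 0 = G.word.get j ∧
        τ.mem = mem := by
  obtain ⟨n, mem₀, hs, hmem⟩ := h
  have hw' := hw
  unfold Roomy at hw'
  have hm := G.numVars_pos
  have hj := j.isLt
  have hr := reach_last (G := G)
  have hlen : G.len (G.numVars - 1) = G.word.length := by rw [len, str_last]
  have hoff := hs.off_le _ hr
  have hfld := read_field hmem
  have i1 : G.numVars - 1 < 3 * G.numVars := by omega
  have e2 : mem 2 = G.numVars := by rw [hmem, Function.update_self]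
  rw [hlen] at hoff
  simp [queryProg, block, start, e2, hfld, WordRAM.fieldAddr_lt, hw.fieldAddr_lt, i1]
  refine ⟨by omega, by omega, ?_⟩
  refine WP.while (w := w) (by omega) 250 (G.QueryInv n mem₀ (G.word.get j))
    (fun _ _ _ => safe_reg ..) (fun i σ hI hc => queryBody_spec hw hs hI hc)
    -- The weight, the level and the room contribute at most `log₂ N` each; the additional step
    -- reads the terminal symbol.
    (3 * Nat.log 2 G.word.length + 1) ?_ ?_
  · refine ⟨hmem, by simp, .inr ⟨by simp, ?_⟩⟩
    have hcov : G.Covers mem₀ (G.numVars - 1) (j.val + G.field mem₀ 9 (G.numVars - 1)) :=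
      ⟨by omega, by omega⟩
    obtain ⟨x, h1, h2, h3, h4, h5, h6⟩ := hs.exists_exit hr hcov
    have ht := hs.inTask_root h1.reach
    have htr := hs.inTask_root hr
    rw [h2] at ht
    refine ⟨x, by simpa using h1, by simpa using ht, ?_, ?_⟩
    · simp [h6, str_last]
    · have hc := (hs.chain _ ht.lt).level_eq htr.lo_le htr.lt_hi
      rw [hs.entry _ hr] at hc
      have hlev : G.level (G.numVars - 1) = Nat.log 2 G.word.length := by rw [level, hlen]
      have hw1 : Nat.log 2 (G.weight mem₀ (G.field mem₀ 11 (G.field mem₀ 8 (G.numVars - 1)))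
          (G.field mem₀ 12 (G.field mem₀ 8 (G.numVars - 1)))) ≤ Nat.log 2 G.word.length := by
        rw [← hlev, hc]
        exact Nat.log_mono_right (Nat.sub_le _ _)
      have hroom : G.room x ≤ Nat.log 2 G.word.length :=
        Nat.log_mono_right (Nat.div_le_self _ _)
      simp
      omega
  · rintro t' i τ ht ⟨q, q0, ⟨-, q5⟩ | ⟨q4, -⟩⟩ hc
    · simp at ht
      simp [q5, q, hmem]
      omega
    · rw [eval_reg, q4] at hc
      omega

/-- The preprocessing program. -/
def preProg : Prog := block [countProg, fillProg, layoutProg, searchProg]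

theorem preProg_spec (hw : G.Roomy w) :
    WP w (51 * G.numVars) preProg (start G.numVars G.inputMem) 0 fun t τ =>
      t ≤ 3000 * (G.numVars * (Nat.log 2 G.numVars + 1)) ∧ G.Ready τ.mem := by
  have hm := G.numVars_pos
  refine (countProg_spec hw (by simp [start]) rfl 0).mono fun t₁ σ₁ ⟨h1, hσ₁⟩ => ?_
  refine (fillProg_spec hw hσ₁ t₁).mono fun t₂ σ₂ ⟨h2, h0, hσ₂⟩ => ?_
  refine (layoutProg_spec hw h0 hσ₂ t₂).mono fun t₃ σ₃ ⟨h3, hσ₃⟩ => ?_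
  refine (searchProg_spec hw hσ₃ t₃).mono fun t₄ σ₄ ⟨h4, hσ₄⟩ => ⟨?_, hσ₄⟩
  have h5 : 3 * G.numVars * (110 * (Nat.log 2 G.numVars + 1) + 310) =
    330 * (G.numVars * (Nat.log 2 G.numVars + 1)) + 930 * G.numVars := by ring
  have h6 : G.numVars ≤ G.numVars * (Nat.log 2 G.numVars + 1) :=
    Nat.le_mul_of_pos_right _ (Nat.succ_pos _)
  omega

/-! ### Word length, input words, and conversion to natural logarithms -/

theorem roomy_of_pow_le (h : (G.size + G.word.length) ^ 8 ≤ 2 ^ w) : G.Roomy w := by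
  refine lt_of_lt_of_le ?_ h
  have h1 := two_mul_numVars_le_size (G := G)
  have h2 := G.numVars_pos
  have h3 := reach_last (G := G)
  have h4 : 0 < G.word.length := by
    rw [← str_last]
    exact len_pos h3.1
  obtain ⟨x, hx⟩ : ∃ x, G.size + G.word.length = x := ⟨_, rfl⟩
  -- As `x = n + N` is at least 3, the eighth power exceeds `x` by the factor `3 ^ 7 = 2187`, enough
  -- for all constants in `Roomy`.
  have h5 : 3 ^ 7 * x ≤ x ^ 8 := by
    rw [pow_succ x 7]
    exact Nat.mul_le_mul_right _ (Nat.pow_le_pow_left (by omega) 7)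
  rw [hx]
  refine lt_of_lt_of_le ?_ h5
  norm_num
  omega

theorem inputMem_lt (hw : G.Roomy w)
    (hterm : ∀ (k : Fin G.numVars) (a : ℕ), G.rule k = SLPRule.terminal a → a < 2 ^ w) (j : ℕ) :
    G.inputMem j < 2 ^ w := by
  unfold Roomy at hw
  unfold inputMem
  split
  · next h =>
    cases hr : G.rule ⟨j / 3, h⟩ with
    | terminal a =>
      have := hterm _ a hr
      generalize (⟨j % 3, _⟩ : Fin 3) = i
      fin_cases i
      exacts [show 0 < 2 ^ w by omega, this, show 0 < 2 ^ w by omega]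
    | pair l r =>
      have hl : l.val < j / 3 := l.isLt
      have hr : r.val < j / 3 := r.isLt
      generalize (⟨j % 3, _⟩ : Fin 3) = i
      fin_cases i
      exacts [show 1 < 2 ^ w by omega, show l.val < 2 ^ w by omega, show r.val < 2 ^ w by omega]
  · omega

theorem start_words {x : ℕ} {m : ℕ → ℕ} (hx : x < 2 ^ w) (hm : ∀ j, m j < 2 ^ w) :
    (start x m).Words w := by
  refine ⟨fun r => ?_, hm⟩
  simp only [start, Function.update_apply]
  split
  · exact hx
  · simp

theorem natLog_le (n : ℕ) : (Nat.log 2 n : ℝ) ≤ 2 * Real.log n := by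
  rcases Nat.eq_zero_or_pos n with rfl | hn
  · simp
  have h1 : (2 : ℝ) ^ Nat.log 2 n ≤ n := by exact_mod_cast Nat.pow_log_le_self 2 hn.ne'
  have h2 := Real.log_le_log (by positivity) h1
  rw [Real.log_pow] at h2
  have h3 := Real.log_two_gt_d9
  nlinarith [(Nat.cast_nonneg (Nat.log 2 n) : (0 : ℝ) ≤ _)]

/-- The size is at least 2, so its logarithm is at least `log 2 > 1/2` and absorbs the additive 1;
this allows a bound without an additive term. -/
theorem numVars_mul_log_le :
    ((G.numVars * (Nat.log 2 G.numVars + 1) : ℕ) : ℝ) ≤ 2 * (G.size * Real.log G.size) := by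
  have h1 : (2 * G.numVars : ℝ) ≤ G.size := by exact_mod_cast two_mul_numVars_le_size (G := G)
  have h2 : (1 : ℝ) ≤ G.numVars := by exact_mod_cast G.numVars_pos
  have h3 := natLog_le G.numVars
  have h4 : Real.log G.numVars ≤ Real.log G.size := Real.log_le_log (by linarith) (by linarith)
  have h5 : Real.log 2 ≤ Real.log G.size := Real.log_le_log (by norm_num) (by linarith)
  have h6 := Real.log_two_gt_d9
  push_cast
  calc (G.numVars : ℝ) * (Nat.log 2 G.numVars + 1)
      ≤ (G.size / 2) * (4 * Real.log G.size) :=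
        mul_le_mul (by linarith) (by linarith) (by positivity) (by linarith)
    _ = 2 * (G.size * Real.log G.size) := by ring

end SLP

theorem mainTheorem4 :
    ∃ (pre query : WordRAM.Prog) (C : ℝ) (c : ℕ),
      ∀ (G : SLP) (w : ℕ),
        -- words have at least `c * log₂ (n + N)` bits, and every terminal symbol fits in a word
        (G.size + G.word.length) ^ c ≤ 2 ^ w →
        (∀ (k : Fin G.numVars) (a : ℕ), G.rule k = SLPRule.terminal a → a < 2 ^ w) →
        ∃ (s t : ℕ) (σ : WordRAM.State),
          3 * G.numVars ≤ s ∧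
          (s : ℝ) ≤ C * (G.size * Real.log G.size) ∧
          (t : ℝ) ≤ C * (G.size * Real.log G.size) ∧
          WordRAM.Exec w s pre (WordRAM.start G.numVars G.inputMem) t σ ∧
          ∀ i : Fin G.word.length,
            ∃ (u : ℕ) (τ : WordRAM.State),
              (u : ℝ) ≤ C * (1 + Real.log G.word.length) ∧
              WordRAM.Exec w s query (WordRAM.start (i.val + 1) σ.mem) u τ ∧
              τ.reg 0 = G.word.get i ∧
              τ.mem = σ.mem := by
  -- The constant is 3000 from `preProg_spec` times the factor 2 of `numVars_mul_log_le`; it also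
  -- dominates the cell count and the query time. The exponent 8 is the one in `roomy_of_pow_le`.
  refine ⟨SLP.preProg, SLP.queryProg, 6000, 8, fun G w hpow hterm => ?_⟩
  have hw := SLP.roomy_of_pow_le hpow
  have hw' := hw
  unfold SLP.Roomy at hw'
  have hlog := SLP.numVars_mul_log_le (G := G)
  obtain ⟨t, σ, hexec, hwords, ht, hready⟩ := (SLP.preProg_spec hw).exec (by omega)
    (SLP.start_words (by omega) (SLP.inputMem_lt hw hterm))
  rw [zero_add] at ht
  refine ⟨51 * G.numVars, t, σ, by omega, ?_, ?_, hexec, fun i => ?_⟩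
  · have h1 : 51 * G.numVars ≤ 3000 * (G.numVars * (Nat.log 2 G.numVars + 1)) := by
      have := Nat.le_mul_of_pos_right G.numVars (Nat.succ_pos (Nat.log 2 G.numVars))
      simp only [Nat.succ_eq_add_one] at this
      omega
    have h2 : ((51 * G.numVars : ℕ) : ℝ) ≤
      ((3000 * (G.numVars * (Nat.log 2 G.numVars + 1)) : ℕ) : ℝ) := Nat.cast_le.2 h1
    rw [Nat.cast_mul 3000] at h2
    push_cast at h2 hlog ⊢
    linarith
  · have h2 : (t : ℝ) ≤ ((3000 * (G.numVars * (Nat.log 2 G.numVars + 1)) : ℕ) : ℝ) :=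
      Nat.cast_le.2 ht
    rw [Nat.cast_mul 3000] at h2
    push_cast at h2 hlog ⊢
    linarith
  · have hi := i.isLt
    obtain ⟨u, τ, hexec', -, hu, hout, hmem⟩ := (SLP.queryProg_spec hw hready i).exec (by omega)
      (SLP.start_words (by omega) hwords.2)
    rw [zero_add] at hu
    refine ⟨u, τ, ?_, hexec', hout, hmem⟩
    have h1 := SLP.natLog_le G.word.length
    have h2 : (u : ℝ) ≤ ((260 * (3 * Nat.log 2 G.word.length + 1) + 100 : ℕ) : ℝ) :=
      Nat.cast_le.2 hu
    have h3 : 0 ≤ Real.log G.word.length := Real.log_natCast_nonneg _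
    push_cast at h2
    linarith
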